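/- Let $V$ be a finite set of points in the plane, with $d_2$ the Euclidean distance. Around each $u\in V$ consider the four quadrants $Q_1(u),\dots,Q_4(u)$ with apex $u$ bounded by the axis-parallel lines through $u$, each containing its clockwise bounding ray but neither its counterclockwise bounding ray nor $u$ itself. A (Euclidean) Yao graph $Y_4$ on $V$ is obtained by choosing, for every $u\in V$ and every $i$ for which $Q_i(u)$ contains a point of $V$, one point $v\in V\cap Q_i(u)$ that minimizes $d_2(u,v)$ (ties are broken arbitrarily), and taking the undirected edge $(u,v)$. Let $Del^\infty$ be the $L_\infty$-Delaunay triangulation of $V$: distinct points $u,v\in V$ are joined by an edge if and only if there is an axis-aligned square (of positive side length) with $u$ and $v$ on its boundary and no point of $V$ in its interior. The length of a path is the sum of the Euclidean lengths of its edges. Then for every finite $V$ and every Yao graph $Y_4$ on $V$: 1. For every edge $(a,b)$ of $Del^\infty$ there is a path in $Y_4$ from $a$ to $b$ of length at most $(11+7\sqrt2)\,d_2(a,b)$. 2. The stretch factor of $Y_4$ is at most $(11+7\sqrt2)\sqrt{4+2\sqrt2}$; that is, for all $u,v\in V$, the length of a shortest path from $u$ to $v$ in $Y_4$ is at most $(11+7\sqrt2)\sqrt{4+2\sqrt2}$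 times the length of a shortest path from $u$ to $v$ in the complete graph on $V$ (which is $d_2(u,v)$). -/

import Mathlib

open scoped ENNReal

/-- The Euclidean plane; `dist` on it is the Euclidean distance `d₂`. -/
abbrev Plane : Type := EuclideanSpace ℝ (Fin 2)

/-- The `L_∞`-distance. -/
noncomputable def dInf (p q : Plane) : ℝ := max |p 0 - q 0| |p 1 - q 1|

/-- The boundary of the axis-aligned square with centre `c` and side length `2 * r`. -/
def squareBoundary (c : Plane) (r : ℝ) : Set Plane := {p | dInf c p = r}

/-- The interior of the axis-aligned square with centre `c` and side length `2 * r`. -/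
def squareInterior (c : Plane) (r : ℝ) : Set Plane := {p | dInf c p < r}

/-- The `L_∞`-Delaunay graph on `V`: distinct vertices `u`, `v` are adjacent iff some axis-aligned
square (of positive side length) has `u` and `v` on its boundary and no vertex in its interior. -/
def delInf (V : Finset Plane) : SimpleGraph V where
  Adj u v := u ≠ v ∧ ∃ (c : Plane) (r : ℝ), 0 < r ∧
    (u : Plane) ∈ squareBoundary c r ∧ (v : Plane) ∈ squareBoundary c r ∧
    ∀ w : V, (w : Plane) ∉ squareInterior c r
  symm := ⟨fun _ _ ⟨hne, c, r, hr, hu, hv, hw⟩ => ⟨hne.symm, c, r, hr, hv, hu, hw⟩⟩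
  loopless := ⟨fun _ h => h.1 rfl⟩

/-- The four quadrants with apex `u` (the apex itself excluded), in counterclockwise order starting
with the first one. Each contains its clockwise bounding ray and not its counterclockwise one. -/
def quadrant (u : Plane) : Fin 4 → Set Plane
  | 0 => {v | 0 < v 0 - u 0 ∧ 0 ≤ v 1 - u 1}
  | 1 => {v | v 0 - u 0 ≤ 0 ∧ 0 < v 1 - u 1}
  | 2 => {v | v 0 - u 0 < 0 ∧ v 1 - u 1 ≤ 0}
  | 3 => {v | 0 ≤ v 0 - u 0 ∧ v 1 - u 1 < 0}

/-- `E` is the edge relation of a directed Yao graph `Y₄` on `V`, for some way of breaking ties: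
in every quadrant of every vertex `u` that contains a vertex, exactly one edge leaves `u`, and
every edge goes to a vertex at minimum Euclidean distance from `u` in its quadrant. -/
structure IsDirectedYaoFour (V : Finset Plane) (E : V → V → Prop) : Prop where
  existsUnique_edge : ∀ (u : V) (i : Fin 4), (∃ w : V, (w : Plane) ∈ quadrant u i) →
    ∃! v : V, (v : Plane) ∈ quadrant u i ∧ E u v
  edge_shortest : ∀ u v : V, E u v → ∃ i : Fin 4, (v : Plane) ∈ quadrant u i ∧
    ∀ w : V, (w : Plane) ∈ quadrant u i → dist (u : Plane) v ≤ dist (u : Plane) w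

/-- `G` is an undirected Yao graph `Y₄` on `V`: some directed Yao graph `Y₄` on `V` with the
directions of its edges forgotten. -/
def IsYaoFour (V : Finset Plane) (G : SimpleGraph V) : Prop :=
  ∃ E : V → V → Prop, IsDirectedYaoFour V E ∧ ∀ u v : V, G.Adj u v ↔ E u v ∨ E v u

/-- The length of a walk: the sum of the Euclidean lengths of its edges. -/
noncomputable def walkLength {V : Finset Plane} {G : SimpleGraph V} :
    {u v : V} → G.Walk u v → ℝ
  | _, _, .nil => 0
  | _, _, .cons (u := u) (v := v) _ p => dist (u : Plane) (v : Plane) + walkLength p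

/-- The distance `d_G(u, v)`: the least length of a path from `u` to `v` in `G`
(infinite if there is none). -/
noncomputable def graphDist {V : Finset Plane} (G : SimpleGraph V) (u v : V) : ℝ≥0∞ :=
  ⨅ p : G.Path u v, ENNReal.ofReal (walkLength p.1)

/-- `H` is a `t`-spanner of `G`. -/
def IsSpannerOf {V : Finset Plane} (t : ℝ) (H G : SimpleGraph V) : Prop :=
  ∀ u v : V, graphDist H u v ≤ ENNReal.ofReal t * graphDist G u v

/-- `H` is a `t`-spanner of `V` (its stretch factor is at most `t`): it is a `t`-spanner of the
complete graph on `V`. -/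
def IsSpanner {V : Finset Plane} (t : ℝ) (H : SimpleGraph V) : Prop :=
  IsSpannerOf t H ⊤

/-!
# Walks in the Yao graph `Y₄`

Any two vertices `p`, `o` are joined by a walk whose length is at most `20.89` times their distance
in the maximum norm. Since `20.89 ≤ 11 + 7√2` and the maximum norm is at most the Euclidean one,
both claims follow, and the Delaunay triangulation plays no further role.

By induction on the distance (`IsYaoFour.walkReach`) it suffices to prove a contraction property,
`Frame.Win`, for pairs `p`, `o` at distance `1`: there are walks from `p` to some `a` and from `o`
to some `b`, of total length at most `20.89 (1 - n)`, such that `a` and `b` are at distance at most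
`n < 1`. A `Frame` records coordinates, quadrants and hops to nearest neighbours in them; frames can
be reflected and rotated, so `p` may be put on the west side of the square of radius `1` around `o`,
which is the origin, and not below `o`.

*The sweep.* From `p` the walk moves along the west side of the square, through vertices `u` which
it reaches at cost `1.4 - Y u + 9 (1 + X u)` and whose north-eastern quadrant is empty up to
distance `0.8 (0.7 - Y u) - (1 + X u)` (`Frame.IsSweepVertex`). If the south-eastern neighbour of
`u` is not too far away, the walk hops there and climbs by north-eastern hops until the invariant
holds again (`win_or_exists_isSweepVertex`); the emptiness of the quadrant of `u` forces each climb
that passes the height of `u` to have moved east enough to pay for itself (`sweep_inequality`). Near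
the north-western corner the sweep is started by a chain of south-eastern hops, after a reflection
in the diagonal if necessary.

*The last vertex.* For the easternmost vertex `c` of the sweep, both eastern quadrants are empty up
to definite distances. One of them contains `o`, and after a reflection it is the south-eastern
one (`Frame.IsTerminal`). Hop from `c` to its south-eastern neighbour `e`, climb from there by
north-eastern hops towards `o` to a last vertex `E` south-west of `o`, and hop from `E` to `W`,
which is no further from `E` than `o` is (`Frame.IsFan`). Unless `W` is close to `o` there are two
possibilities.

* `W` is north-east of `c`. The circle around `E` through `o` confines `W`, and the empty quadrants
  of `c` push `W` towards the east and so towards `o`. This is enough unless `c` is far above `o`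
  (`win_of_fan_north_upper`, `win_of_fan_north_lower`). In the remaining case, south-eastern hops
  from `W` followed by a second chain of north-eastern hops produce a second fan, which cannot end
  north of `c` again (`win_of_fan_north_high`, `false_of_second_north`).
* `W` is south-east of `o`. If `W` is not close to `o`, then `e` and `E` lie far below `o`, and a
  chain of south-western hops from `o` leads to a vertex near one of `c`, `e`, `E`, `W`
  (`win_of_fan_south_of_low`).

Every numerical constant below is chosen so that the resulting finitely many inequalities hold
with the factor `20.89`.
-/

/-! ### Frames -/

/-- The Euclidean distance of two vertices with coordinates `X` and `Y`. -/
noncomputable def coordDist {V : Type*} (X Y : V → ℝ) (u v : V) : ℝ :=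
  Real.sqrt ((X v - X u) ^ 2 + (Y v - Y u) ^ 2)

/-- A frame for a Yao graph on `V`: coordinates, the relations "`v` lies in the north-east
(south-east) quadrant of `u`" — their converses describe the south-west and north-west quadrants —
and the relation `reach u v c`: some walk from `u` to `v` has length at most `c`.
Which of its two bounding rays a quadrant contains is left open, so that frames can be reflected. -/
structure Frame (V : Type*) where
  X : V → ℝ
  Y : V → ℝ
  NE : V → V → Prop
  SE : V → V → Prop
  reach : V → V → ℝ → Prop
  ne_le : ∀ {u v}, NE u v → X u ≤ X v ∧ Y u ≤ Y v
  se_le : ∀ {u v}, SE u v → X u ≤ X v ∧ Y v ≤ Y u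
  ne_irrefl : ∀ u, ¬ NE u u
  se_irrefl : ∀ u, ¬ SE u u
  total : ∀ {u v}, u ≠ v → NE u v ∨ SE u v ∨ NE v u ∨ SE v u
  east_trans : ∀ {u v w}, NE u v ∨ SE u v → NE v w ∨ SE v w → NE u w ∨ SE u w
  north_trans : ∀ {u v w}, NE u v ∨ SE v u → NE v w ∨ SE w v → NE u w ∨ SE w u
  hop_ne : ∀ {u z}, NE u z → ∃ w, NE u w ∧ reach u w (coordDist X Y u w) ∧
    ∀ x, NE u x → coordDist X Y u w ≤ coordDist X Y u x
  hop_se : ∀ {u z}, SE u z → ∃ w, SE u w ∧ reach u w (coordDist X Y u w) ∧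
    ∀ x, SE u x → coordDist X Y u w ≤ coordDist X Y u x
  hop_sw : ∀ {u z}, NE z u → ∃ w, NE w u ∧ reach u w (coordDist X Y u w) ∧
    ∀ x, NE x u → coordDist X Y u w ≤ coordDist X Y u x
  hop_nw : ∀ {u z}, SE z u → ∃ w, SE w u ∧ reach u w (coordDist X Y u w) ∧
    ∀ x, SE x u → coordDist X Y u w ≤ coordDist X Y u x
  reach_refl : ∀ u, reach u u 0
  reach_mono : ∀ {u v a b}, reach u v a → a ≤ b → reach u v b
  reach_trans : ∀ {u v w a b}, reach u v a → reach v w b → reach u w (a + b)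

namespace Frame

variable {V : Type*} (F : Frame V)

/-- The distance of two vertices, in the coordinates of the frame. -/
noncomputable def d (u v : V) : ℝ := coordDist F.X F.Y u v

/-- `v` lies in one of the two eastern quadrants of `u`. -/
def East (u v : V) : Prop := F.NE u v ∨ F.SE u v

theorem d_nonneg (u v : V) : 0 ≤ F.d u v := Real.sqrt_nonneg _

theorem d_sq (u v : V) : F.d u v ^ 2 = (F.X v - F.X u) ^ 2 + (F.Y v - F.Y u) ^ 2 :=
  Real.sq_sqrt (by positivity)

theorem d_sq_le {u v w : V} (h : F.d u v ≤ F.d u w) :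
    (F.X v - F.X u) ^ 2 + (F.Y v - F.Y u) ^ 2 ≤ (F.X w - F.X u) ^ 2 + (F.Y w - F.Y u) ^ 2 := by
  rw [← F.d_sq, ← F.d_sq]
  exact pow_le_pow_left₀ (F.d_nonneg _ _) h 2

theorem d_le_add (u v : V) : F.d u v ≤ |F.X v - F.X u| + |F.Y v - F.Y u| := by
  apply Real.sqrt_le_iff.2
  constructor
  · positivity
  · nlinarith [abs_nonneg (F.X v - F.X u), abs_nonneg (F.Y v - F.Y u),
      sq_abs (F.X v - F.X u), sq_abs (F.Y v - F.Y u)]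

theorem abs_X_le_d (u v : V) : |F.X v - F.X u| ≤ F.d u v :=
  abs_le_of_sq_le_sq (by rw [d_sq]; nlinarith [sq_nonneg (F.Y v - F.Y u)]) (F.d_nonneg _ _)

theorem abs_Y_le_d (u v : V) : |F.Y v - F.Y u| ≤ F.d u v :=
  abs_le_of_sq_le_sq (by rw [d_sq]; nlinarith [sq_nonneg (F.X v - F.X u)]) (F.d_nonneg _ _)

theorem d_le_of_NE {u v : V} (h : F.NE u v) : F.d u v ≤ (F.X v - F.X u) + (F.Y v - F.Y u) := by
  obtain ⟨h1, h2⟩ := F.ne_le h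
  have := F.d_le_add u v
  rwa [abs_of_nonneg (by linarith), abs_of_nonneg (by linarith)] at this

theorem d_le_of_SE {u v : V} (h : F.SE u v) : F.d u v ≤ (F.X v - F.X u) + (F.Y u - F.Y v) := by
  obtain ⟨h1, h2⟩ := F.se_le h
  have := F.d_le_add u v
  rwa [abs_of_nonneg (by linarith), abs_of_nonpos (by linarith), neg_sub] at this

theorem d_comm (u v : V) : F.d u v = F.d v u := by
  unfold d coordDist
  congr 1
  ring

theorem east_of_lt {u v : V} (h : F.X u < F.X v) : F.East u v := by
  have hne : u ≠ v := by rintro rfl; exact lt_irrefl _ h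
  rcases F.total hne with h' | h' | h' | h'
  · exact Or.inl h'
  · exact Or.inr h'
  · linarith [(F.ne_le h').1]
  · linarith [(F.se_le h').1]

theorem NE_of_lt {u v : V} (h : F.X u < F.X v) (h2 : F.Y u < F.Y v) : F.NE u v := by
  rcases F.east_of_lt h with h' | h'
  · exact h'
  · linarith [(F.se_le h').2]

theorem SE_of_lt {u v : V} (h : F.X u < F.X v) (h2 : F.Y v < F.Y u) : F.SE u v := by
  rcases F.east_of_lt h with h' | h'
  · linarith [(F.ne_le h').2]
  · exact h'

/-- Among the vertices with a given property there is an easternmost one. -/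
theorem exists_easternmost [Finite V] {P : V → Prop} {u : V} (hu : P u) :
    ∃ m, P m ∧ ∀ w, F.East m w → ¬ P w := by
  have : IsTrans V (fun a b => F.East b a) := ⟨fun a b c h1 h2 => F.east_trans h2 h1⟩
  have : Std.Irrefl (fun a b => F.East b a) :=
    ⟨fun a h => h.elim (F.ne_irrefl a) (F.se_irrefl a)⟩
  have wf : WellFounded (fun a b => F.East b a) :=
    Finite.wellFounded_of_trans_of_irrefl _
  obtain ⟨m, hm, hmin⟩ := wf.has_min {v | P v} ⟨u, hu⟩
  exact ⟨m, hm, fun w hw hP => hmin w hP hw⟩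

/-- Among the vertices with a given property there is a westernmost one. -/
theorem exists_westernmost [Finite V] {P : V → Prop} {u : V} (hu : P u) :
    ∃ m, P m ∧ ∀ w, F.East w m → ¬ P w := by
  have : IsTrans V (fun a b => F.East a b) := ⟨fun a b c h1 h2 => F.east_trans h1 h2⟩
  have : Std.Irrefl (fun a b => F.East a b) :=
    ⟨fun a h => h.elim (F.ne_irrefl a) (F.se_irrefl a)⟩
  have wf : WellFounded (fun a b => F.East a b) :=
    Finite.wellFounded_of_trans_of_irrefl _
  obtain ⟨m, hm, hmin⟩ := wf.has_min {v | P v} ⟨u, hu⟩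
  exact ⟨m, hm, fun w hw hP => hmin w hP hw⟩

/-- The frame reflected in the horizontal axis. -/
def refl : Frame V where
  X := F.X
  Y := fun v => - F.Y v
  NE := F.SE
  SE := F.NE
  reach := F.reach
  ne_le h := ⟨(F.se_le h).1, neg_le_neg (F.se_le h).2⟩
  se_le h := ⟨(F.ne_le h).1, neg_le_neg (F.ne_le h).2⟩
  ne_irrefl := F.se_irrefl
  se_irrefl := F.ne_irrefl
  total h := by rcases F.total h with h | h | h | h <;> tauto
  east_trans h1 h2 := (F.east_trans h1.symm h2.symm).symm
  north_trans h1 h2 := (F.north_trans h2.symm h1.symm).symm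
  hop_ne {u z} h := by simpa [coordDist, neg_add_eq_sub, sub_sq_comm] using F.hop_se h
  hop_se {u z} h := by simpa [coordDist, neg_add_eq_sub, sub_sq_comm] using F.hop_ne h
  hop_sw {u z} h := by simpa [coordDist, neg_add_eq_sub, sub_sq_comm] using F.hop_nw h
  hop_nw {u z} h := by simpa [coordDist, neg_add_eq_sub, sub_sq_comm] using F.hop_sw h
  reach_refl := F.reach_refl
  reach_mono := F.reach_mono
  reach_trans := F.reach_trans

/-- The frame rotated by a right angle: its east is the south of `F`. -/
def rot : Frame V where
  X := fun v => - F.Y v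
  Y := F.X
  NE := F.SE
  SE := fun u v => F.NE v u
  reach := F.reach
  ne_le h := ⟨neg_le_neg (F.se_le h).2, (F.se_le h).1⟩
  se_le h := ⟨neg_le_neg (F.ne_le h).2, (F.ne_le h).1⟩
  ne_irrefl := F.se_irrefl
  se_irrefl := F.ne_irrefl
  total h := by rcases F.total h with h | h | h | h <;> tauto
  east_trans h1 h2 := (F.north_trans h2.symm h1.symm).symm
  north_trans h1 h2 := (F.east_trans h1.symm h2.symm).symm
  hop_ne {u z} h := by simpa [coordDist, neg_add_eq_sub, sub_sq_comm, add_comm,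
    ← sub_eq_add_neg] using F.hop_se h
  hop_se {u z} h := by simpa [coordDist, neg_add_eq_sub, sub_sq_comm, add_comm,
    ← sub_eq_add_neg] using F.hop_sw h
  hop_sw {u z} h := by simpa [coordDist, neg_add_eq_sub, sub_sq_comm, add_comm,
    ← sub_eq_add_neg] using F.hop_nw h
  hop_nw {u z} h := by simpa [coordDist, neg_add_eq_sub, sub_sq_comm, add_comm,
    ← sub_eq_add_neg] using F.hop_ne h
  reach_refl := F.reach_refl
  reach_mono := F.reach_mono
  reach_trans := F.reach_trans

/-- The contraction property of a pair `p`, `o` at distance `1` in the maximum norm: walks from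
`p` to `a` and from `o` to `b` whose total length is at most `20.89` times the amount by which
`a` and `b` are closer to each other than `p` and `o`. -/
def Win (p o : V) : Prop :=
  ∃ (a b : V) (c c' n : ℝ), F.reach p a c ∧ F.reach o b c' ∧ |F.X a - F.X b| ≤ n ∧
    |F.Y a - F.Y b| ≤ n ∧ n < 1 ∧ c + c' ≤ 20.89 * (1 - n)

theorem win_of_refl {p o : V} (h : F.refl.Win p o) : F.Win p o := by
  obtain ⟨a, b, c, c', n, h1, h2, h3, h4, h5⟩ := h
  refine ⟨a, b, c, c', n, h1, h2, h3, ?_, h5⟩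
  have : |-F.Y a - -F.Y b| ≤ n := h4
  rwa [← abs_neg, show -(F.Y a - F.Y b) = -F.Y a - -F.Y b by ring]

theorem win_of_rot {p o : V} (h : F.rot.Win p o) : F.Win p o := by
  obtain ⟨a, b, c, c', n, h1, h2, h3, h4, h5⟩ := h
  refine ⟨a, b, c, c', n, h1, h2, h4, ?_, h5⟩
  have : |-F.Y a - -F.Y b| ≤ n := h3
  rwa [← abs_neg, show -(F.Y a - F.Y b) = -F.Y a - -F.Y b by ring]

/-- The contraction property holds if a vertex `a` near `o` is reached cheaply from `p`. -/
theorem win_of_reach {p o a : V} {c n : ℝ} (hX : F.X o = 0) (hY : F.Y o = 0)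
    (h : F.reach p a c) (h1 : F.X a ≤ n) (h2 : -n ≤ F.X a) (h3 : F.Y a ≤ n) (h4 : -n ≤ F.Y a)
    (hn : n < 1) (hc : c ≤ 20.89 * (1 - n)) : F.Win p o :=
  ⟨a, o, c, 0, n, h, F.reach_refl o, by rw [hX, sub_zero]; exact abs_le.2 ⟨h2, h1⟩,
    by rw [hY, sub_zero]; exact abs_le.2 ⟨h4, h3⟩, hn, by linarith⟩

end Frame

/-! ### Walks -/

section Walks

variable {V : Finset Plane} {G : SimpleGraph V}

theorem walkLength_nonneg {u v : V} (p : G.Walk u v) : 0 ≤ walkLength p := by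
  induction p with
  | nil => exact le_rfl
  | cons h p ih => exact add_nonneg dist_nonneg ih

theorem walkLength_append {u v w : V} (p : G.Walk u v) (q : G.Walk v w) :
    walkLength (p.append q) = walkLength p + walkLength q := by
  induction p with
  | nil => simp [walkLength]
  | cons h p ih => simp [walkLength, ih, add_assoc]

theorem walkLength_reverse {u v : V} (p : G.Walk u v) :
    walkLength p.reverse = walkLength p := by
  induction p with
  | nil => rfl
  | cons h p ih => simp [walkLength, walkLength_append, ih, dist_comm, add_comm]

theorem dist_le_walkLength {u v : V} (p : G.Walk u v) : dist (u : Plane) v ≤ walkLength p := by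
  induction p with
  | nil => simp [walkLength]
  | @cons u v w h p ih =>
    have := dist_triangle (u : Plane) v w
    simp only [walkLength]
    linarith

/-- Cutting out loops does not lengthen a walk. -/
theorem exists_isPath_walkLength_le {u v : V} (p : G.Walk u v) :
    ∃ q : G.Walk u v, q.IsPath ∧ walkLength q ≤ walkLength p := by
  classical
  induction p with
  | nil => exact ⟨.nil, .nil, le_rfl⟩
  | @cons u v w h p ih =>
    obtain ⟨q, hq, hle⟩ := ih
    by_cases hu : u ∈ q.support
    · refine ⟨q.dropUntil u hu, hq.dropUntil hu, ?_⟩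
      have h1 := congrArg walkLength (q.take_spec hu)
      rw [walkLength_append] at h1
      have h2 := walkLength_nonneg (q.takeUntil u hu)
      have h3 : 0 ≤ dist (u : Plane) (v : Plane) := dist_nonneg
      simp only [walkLength]
      linarith
    · exact ⟨.cons h q, hq.cons hu, by simpa [walkLength] using hle⟩

/-- Some walk from `u` to `v` has length at most `c`. -/
def WalkReach (G : SimpleGraph V) (u v : V) (c : ℝ) : Prop :=
  ∃ p : G.Walk u v, walkLength p ≤ c

theorem WalkReach.refl (u : V) : WalkReach G u u 0 := ⟨.nil, le_rfl⟩

theorem WalkReach.mono {u v : V} {a b : ℝ} (h : WalkReach G u v a) (hab : a ≤ b) :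
    WalkReach G u v b := h.imp fun _ hp => hp.trans hab

theorem WalkReach.trans {u v w : V} {a b : ℝ} (h : WalkReach G u v a) (h' : WalkReach G v w b) :
    WalkReach G u w (a + b) := by
  obtain ⟨p, hp⟩ := h
  obtain ⟨q, hq⟩ := h'
  exact ⟨p.append q, by rw [walkLength_append]; exact add_le_add hp hq⟩

theorem WalkReach.symm {u v : V} {a : ℝ} (h : WalkReach G u v a) : WalkReach G v u a := by
  obtain ⟨p, hp⟩ := h
  exact ⟨p.reverse, by rwa [walkLength_reverse]⟩

theorem WalkReach.of_adj {u v : V} (h : G.Adj u v) : WalkReach G u v (dist (u : Plane) v) :=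
  ⟨.cons h .nil, by simp [walkLength]⟩

end Walks

/-! ### The frame of a Yao graph -/

section BaseFrame

variable {V : Finset Plane} {G : SimpleGraph V}

theorem plane_dist (p q : Plane) : dist p q = √((q 0 - p 0) ^ 2 + (q 1 - p 1) ^ 2) := by
  rw [EuclideanSpace.dist_eq, Fin.sum_univ_two, Real.dist_eq, Real.dist_eq, sq_abs, sq_abs]
  congr 1
  ring

theorem dInf_le_dist (p q : Plane) : dInf p q ≤ dist p q := by
  rw [plane_dist]
  refine max_le ?_ ?_ <;> apply Real.abs_le_sqrt <;> nlinarith [sq_nonneg (p 0 - q 0),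
    sq_nonneg (p 1 - q 1)]

theorem mem_quadrant_zero {u v : Plane} : v ∈ quadrant u 0 ↔ u 0 < v 0 ∧ u 1 ≤ v 1 :=
  and_congr sub_pos sub_nonneg

theorem mem_quadrant_one {u v : Plane} : v ∈ quadrant u 1 ↔ v 0 ≤ u 0 ∧ u 1 < v 1 :=
  and_congr sub_nonpos sub_pos

theorem mem_quadrant_two {u v : Plane} : v ∈ quadrant u 2 ↔ v 0 < u 0 ∧ v 1 ≤ u 1 :=
  and_congr sub_neg sub_nonpos

theorem mem_quadrant_three {u v : Plane} : v ∈ quadrant u 3 ↔ u 0 ≤ v 0 ∧ v 1 < u 1 :=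
  and_congr sub_nonneg sub_neg

theorem quadrant_disjoint {u v : Plane} {i j : Fin 4} (hi : v ∈ quadrant u i)
    (hj : v ∈ quadrant u j) : i = j := by
  fin_cases i <;> fin_cases j <;> first
    | rfl
    | (exfalso; linarith [hi.1, hi.2, hj.1, hj.2])

theorem IsYaoFour.exists_hop (hG : IsYaoFour V G) {u z : V} {i : Fin 4}
    (hz : (z : Plane) ∈ quadrant u i) :
    ∃ w : V, (w : Plane) ∈ quadrant u i ∧ WalkReach G u w (dist (u : Plane) w) ∧
      ∀ x : V, (x : Plane) ∈ quadrant u i → dist (u : Plane) w ≤ dist (u : Plane) x := by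
  obtain ⟨E, hE, hadj⟩ := hG
  obtain ⟨w, ⟨hw, hEw⟩, -⟩ := hE.existsUnique_edge u i ⟨z, hz⟩
  obtain ⟨j, hj, hmin⟩ := hE.edge_shortest u w hEw
  obtain rfl := quadrant_disjoint hw hj
  exact ⟨w, hw, .of_adj ((hadj u w).2 (Or.inl hEw)), hmin⟩

theorem coordDist_scaled (o : Plane) {r : ℝ} (hr : 0 < r) (u v : V) :
    coordDist (fun v : V => ((v : Plane) 0 - o 0) / r) (fun v : V => ((v : Plane) 1 - o 1) / r) u v
      = dist (u : Plane) v / r := by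
  rw [plane_dist, coordDist, ← Real.sqrt_sq hr.le, ← Real.sqrt_div (by positivity),
    Real.sqrt_sq hr.le]
  congr 1
  field_simp
  ring

/-- The frame of a Yao graph with origin `o` and unit of length `r`. -/
noncomputable def IsYaoFour.frame (hG : IsYaoFour V G) (o : Plane) {r : ℝ} (hr : 0 < r) :
    Frame V where
  X v := ((v : Plane) 0 - o 0) / r
  Y v := ((v : Plane) 1 - o 1) / r
  NE u v := (v : Plane) ∈ quadrant u 0
  SE u v := (v : Plane) ∈ quadrant u 3
  reach u v c := WalkReach G u v (c * r)
  ne_le := fun ⟨h1, h2⟩ => by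
    constructor <;> gcongr <;> linarith
  se_le := fun ⟨h1, h2⟩ => by
    constructor <;> gcongr <;> linarith
  ne_irrefl u h := by simpa using h.1
  se_irrefl u h := by simpa using h.2
  total {u v} huv := by
    have : (u : Plane) 0 ≠ (v : Plane) 0 ∨ (u : Plane) 1 ≠ (v : Plane) 1 := by
      by_contra! h
      apply huv
      ext i
      fin_cases i
      exacts [h.1, h.2]
    simp only [mem_quadrant_zero, mem_quadrant_three]
    rcases lt_trichotomy ((u : Plane) 0) ((v : Plane) 0) with h | h | h <;>
      rcases lt_trichotomy ((u : Plane) 1) ((v : Plane) 1) with h' | h' | h' <;>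
      simp_all [le_of_lt]
  east_trans {u v w} h1 h2 := by
    simp only [mem_quadrant_zero, mem_quadrant_three] at *
    generalize (u : Plane) 0 = u0 at *
    generalize (v : Plane) 0 = v0 at *
    generalize (w : Plane) 0 = w0 at *
    generalize (u : Plane) 1 = u1 at *
    generalize (v : Plane) 1 = v1 at *
    generalize (w : Plane) 1 = w1 at *
    grind
  north_trans {u v w} h1 h2 := by
    simp only [mem_quadrant_zero, mem_quadrant_three] at *
    generalize (u : Plane) 0 = u0 at *
    generalize (v : Plane) 0 = v0 at *
    generalize (w : Plane) 0 = w0 at *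
    generalize (u : Plane) 1 = u1 at *
    generalize (v : Plane) 1 = v1 at *
    generalize (w : Plane) 1 = w1 at *
    grind
  hop_ne h := by
    simp only [coordDist_scaled o hr, div_mul_cancel₀ _ hr.ne', div_le_div_iff_of_pos_right hr]
    exact hG.exists_hop h
  hop_se h := by
    simp only [coordDist_scaled o hr, div_mul_cancel₀ _ hr.ne', div_le_div_iff_of_pos_right hr]
    exact hG.exists_hop h
  hop_sw {u z} h := by
    simp only [coordDist_scaled o hr, div_mul_cancel₀ _ hr.ne', div_le_div_iff_of_pos_right hr]
    have hq : ∀ w : V, (u : Plane) ∈ quadrant w 0 ↔ (w : Plane) ∈ quadrant u 2 := fun w =>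
      mem_quadrant_zero.trans mem_quadrant_two.symm
    simp only [hq] at h ⊢
    exact hG.exists_hop h
  hop_nw {u z} h := by
    simp only [coordDist_scaled o hr, div_mul_cancel₀ _ hr.ne', div_le_div_iff_of_pos_right hr]
    have hq : ∀ w : V, (u : Plane) ∈ quadrant w 3 ↔ (w : Plane) ∈ quadrant u 1 := fun w =>
      mem_quadrant_three.trans mem_quadrant_one.symm
    simp only [hq] at h ⊢
    exact hG.exists_hop h
  reach_refl u := by simpa using WalkReach.refl u
  reach_mono h hab := h.mono (by gcongr)
  reach_trans h h' := by simpa [add_mul] using h.trans h'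

end BaseFrame

/-! ### From contraction to short walks -/

section Reduction

variable {V : Finset Plane} {G : SimpleGraph V}

/-- If every pair has the contraction property, then induction on the distance of the pair in the
maximum norm yields walks of length at most `20.89` times that distance. -/
theorem IsYaoFour.walkReach (hG : IsYaoFour V G)
    (contraction : ∀ (F : Frame V) (p o : V), F.X o = 0 → F.Y o = 0 →
      max |F.X p| |F.Y p| = 1 → F.Win p o) (u v : V) :
    WalkReach G u v (20.89 * dInf u v) := by
  by_contra hcon
  -- A counterexample `p`, `o` at minimum distance; its distance becomes the unit of length.
  obtain ⟨⟨p, o⟩, hpo, hmin⟩ := Set.exists_min_image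
    {q : V × V | ¬ WalkReach G q.1 q.2 (20.89 * dInf q.1 q.2)} (fun q => dInf q.1 q.2)
    (Set.toFinite _) ⟨(u, v), hcon⟩
  simp only [Set.mem_ofPred_eq] at hpo hmin
  have hne : (p : Plane) ≠ o := by
    intro h
    obtain rfl := Subtype.ext h
    exact hpo (by simpa [dInf] using WalkReach.refl (G := G) p)
  have hr : 0 < dInf p o := by
    refine lt_of_le_of_ne (le_max_of_le_left (abs_nonneg _)) fun h => hne ?_
    have h0 : |(p : Plane) 0 - (o : Plane) 0| ≤ 0 := (le_max_left _ _).trans h.symm.le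
    have h1 : |(p : Plane) 1 - (o : Plane) 1| ≤ 0 := (le_max_right _ _).trans h.symm.le
    rw [abs_nonpos_iff, sub_eq_zero] at h0 h1
    ext i
    fin_cases i
    exacts [h0, h1]
  set r := dInf p o with hrdef
  obtain ⟨a, b, c, c', n, ⟨wa, hwa⟩, ⟨wb, hwb⟩, hX, hY, hn, hc⟩ :=
    contraction (hG.frame (o : Plane) hr) p o
      (by simp [IsYaoFour.frame]) (by simp [IsYaoFour.frame]) (by
        simp only [IsYaoFour.frame, abs_div, abs_of_pos hr]
        rw [max_div_div_right hr.le]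
        exact div_self hr.ne')
  have hab : dInf a b ≤ n * r := by
    simp only [IsYaoFour.frame, ← sub_div, sub_sub_sub_cancel_right, abs_div, abs_of_pos hr,
      div_le_iff₀ hr] at hX hY
    exact max_le hX hY
  have hlt : dInf a b < r := hab.trans_lt (by nlinarith)
  have hwalk : WalkReach G a b (20.89 * dInf a b) := by
    by_contra h
    exact absurd (hmin (a, b) h) (not_le.2 hlt)
  refine hpo (((WalkReach.trans ⟨wa, hwa⟩ hwalk).trans (WalkReach.symm ⟨wb, hwb⟩)).mono ?_)
  nlinarith [mul_le_mul_of_nonneg_right hc hr.le]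

theorem tau_le : (20.89 : ℝ) ≤ 11 + 7 * √2 := by
  have : (1.413 : ℝ) ≤ √2 := Real.le_sqrt_of_sq_le (by norm_num)
  linarith

theorem one_le_sqrt_four_add : (1 : ℝ) ≤ √(4 + 2 * √2) :=
  Real.le_sqrt_of_sq_le (by nlinarith [Real.sqrt_nonneg 2])

theorem isSpanner_of_forall_walkReach {t : ℝ} (ht : 0 ≤ t)
    (h : ∀ u v : V, WalkReach G u v (t * dist (u : Plane) v)) : IsSpanner t G := by
  intro u v
  obtain ⟨p, hp⟩ := h u v
  obtain ⟨q, hq, hqp⟩ := exists_isPath_walkLength_le p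
  calc graphDist G u v ≤ ENNReal.ofReal (walkLength q) := iInf_le_of_le ⟨q, hq⟩ le_rfl
    _ ≤ ENNReal.ofReal (t * dist (u : Plane) v) := ENNReal.ofReal_le_ofReal (hqp.trans hp)
    _ = ENNReal.ofReal t * ENNReal.ofReal (dist (u : Plane) v) := ENNReal.ofReal_mul ht
    _ ≤ ENNReal.ofReal t * graphDist ⊤ u v := by
      gcongr
      exact le_iInf fun w => ENNReal.ofReal_le_ofReal (dist_le_walkLength w.1)

end Reduction

/-! ### The sweep towards the east -/

/-- The inequality behind one step of the sweep. Here `(ξ, -v)` leads from `u` to `e`, and `(r, q)`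
from `u` to `w`; the north-eastern quadrant of `u` is empty up to distance `θ`, while `w` is at
distance `M < θ + 0.8 v - ξ` from `e`. -/
theorem sweep_inequality {D θ ξ v r q M : ℝ} (hξ : 0 ≤ ξ) (hr : ξ ≤ r) (hv : 0 ≤ v) (hq : 0 ≤ q)
    (hM : 0 ≤ M) (hθ : 0 ≤ θ → θ ^ 2 ≤ r ^ 2 + q ^ 2) (hM2 : M ^ 2 = (r - ξ) ^ 2 + (q + v) ^ 2)
    (hlt : M < θ + 0.8 * v - ξ) (hD : D ≤ ξ + v) :
    θ ≤ 0.8 * q + r ∧ 2 * D - v + ξ + M + q ≤ 9 * r := by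
  have hqv : q + v ≤ M := by nlinarith
  have hθ2 := hθ (by linarith)
  have hsq : M ^ 2 < (θ + 0.8 * v - ξ) ^ 2 := by nlinarith
  -- If `r ≤ θ`, use `θ ^ 2 ≤ r ^ 2 + q ^ 2`; otherwise `(θ - ξ) ^ 2 ≤ (r - ξ) ^ 2`.
  have key : 0.36 * v ^ 2 < v * (1.6 * θ - 2 * q - 1.6 * ξ) := by
    rcases le_total r θ with h | h
    · nlinarith [mul_nonneg hξ (sub_nonneg.2 h)]
    · nlinarith [mul_nonneg (sub_nonneg.2 h) (show 0 ≤ r + θ - 2 * ξ by linarith), sq_nonneg q]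
  have hv0 : 0 < v := by
    rcases hv.eq_or_lt with h | h
    · simp [← h] at key
    · exact h
  have key2 : 0.36 * v < 1.6 * θ - 2 * q - 1.6 * ξ := by
    by_contra! h
    nlinarith [mul_le_mul_of_nonneg_left h hv]
  have h1 : θ ≤ 0.8 * q + r := by
    by_contra! h
    nlinarith [mul_self_lt_mul_self (hξ.trans hr) (show r < θ - 0.8 * q by linarith)]
  -- The weights fit because `2 * ξ + 1.8 * v + θ + q ≤ 9 * θ - 9 * q - 6 * ξ`.
  exact ⟨h1, by linarith⟩

namespace Frame

variable {V : Type*} (F : Frame V)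

/-- The vertices the sweep runs through: they lie in the western part of the square around `o`,
are reached at a cost that grows with their distance from the north-western corner, and have a
north-eastern quadrant which is empty up to a distance that grows with the depth below the top. -/
structure IsSweepVertex (p u : V) : Prop where
  le_X : -1 ≤ F.X u
  X_lt : F.X u < -0.8
  le_Y : -0.75 ≤ F.Y u
  Y_le : F.Y u ≤ 0.7
  reach : F.reach p u (1.4 - F.Y u + 9 * (1 + F.X u))
  empty : ∀ w, F.NE u w → 0.8 * (0.7 - F.Y u) - (1 + F.X u) ≤ F.d u w

variable {F} {p o : V}

/-- A sweep that leaves the western part of the square around `o` has come closer to `o`. -/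
theorem win_of_landing (hX : F.X o = 0) (hY : F.Y o = 0) {a : V} {c : ℝ}
    (h : F.reach p a (1.4 - F.Y a + 9 * (1 + F.X a))) (h' : F.reach p a c) (hc : c ≤ 5.2)
    (h1 : -0.8 ≤ F.X a) (h2 : F.X a ≤ 0.75) (h3 : -0.75 ≤ F.Y a) (h4 : F.Y a ≤ 0.75) :
    F.Win p o := by
  rcases le_total (F.X a) (-0.75) with ha | ha
  · exact F.win_of_reach (n := - F.X a) hX hY h (by linarith) (by linarith) (by linarith)
      (by linarith) (by linarith) (by linarith)
  · exact F.win_of_reach (n := 0.75) hX hY h' (by linarith) (by linarith) (by linarith)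
      (by linarith) (by linarith) (by linarith)

/-- One step of the sweep: it starts with the hop from `u` to its south-eastern neighbour `e₁` and
climbs towards the north-east until the north-eastern quadrant is empty enough. -/
theorem win_or_exists_isSweepVertex [Finite V] (hX : F.X o = 0) (hY : F.Y o = 0) {u e₁ : V}
    (hu : -1 ≤ F.X u) (hreach : F.reach p u (1.4 - F.Y u + 9 * (1 + F.X u)))
    (hempty : ∀ w, F.NE u w → 0.8 * (0.7 - F.Y u) - (1 + F.X u) ≤ F.d u w)
    (he₁ : F.SE u e₁) (hhop : F.reach u e₁ (F.d u e₁)) (hmin : ∀ x, F.SE u x → F.d u e₁ ≤ F.d u x)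
    (hcost : 1.4 - F.Y u + 9 * (1 + F.X u) + F.d u e₁ ≤ 5.2) (hXe₁ : F.X e₁ ≤ 0.75)
    (hYe₁ : -0.75 ≤ F.Y e₁) (hYe₁' : F.Y e₁ ≤ 0.7) :
    F.Win p o ∨ ∃ u', F.East u u' ∧ F.IsSweepVertex p u' := by
  obtain ⟨hx1, hy1⟩ := F.se_le he₁
  have hD := F.d_le_of_SE he₁
  have hDY := F.abs_Y_le_d u e₁
  rw [abs_of_nonpos (by linarith)] at hDY
  set D := F.d u e₁ with hDdef
  have hre₁ := F.reach_trans hreach hhop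
  by_cases hland : -0.8 ≤ F.X e₁
  · exact Or.inl (win_of_landing hX hY (F.reach_mono hre₁ (by linarith)) hre₁ hcost hland hXe₁
      hYe₁ (by linarith))
  have hstart : F.SE u e₁ ∧ F.X e₁ < -0.8 ∧ -0.75 ≤ F.Y e₁ ∧ F.Y e₁ ≤ 0.7 ∧
      F.reach u e₁ (2 * D - (F.Y u - F.Y e₁) + (F.X e₁ - F.X u)) :=
    ⟨he₁, not_le.1 hland, hYe₁, hYe₁', F.reach_mono hhop (by linarith)⟩
  obtain ⟨e, ⟨hue, heX, heY, heY', her⟩, hlast⟩ := F.exists_easternmost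
    (P := fun e => F.SE u e ∧ F.X e < -0.8 ∧ -0.75 ≤ F.Y e ∧ F.Y e ≤ 0.7 ∧
      F.reach u e (2 * D - (F.Y u - F.Y e) + (F.X e - F.X u))) hstart
  obtain ⟨hxe, hye⟩ := F.se_le hue
  -- The chain to `e` stays at distance at least `D` from `u`, as `e₁` is a nearest neighbour.
  have hDe : D ≤ (F.X e - F.X u) + (F.Y u - F.Y e) := (hmin e hue).trans (F.d_le_of_SE hue)
  have hpe : F.reach p e (1.4 - F.Y e + 9 * (1 + F.X e)) :=
    F.reach_mono (F.reach_trans hreach her) (by linarith)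
  by_cases hemp : ∀ w, F.NE e w → 0.8 * (0.7 - F.Y e) - (1 + F.X e) ≤ F.d e w
  · exact Or.inr ⟨e, Or.inr hue, ⟨by linarith, heX, heY, heY', hpe, hemp⟩⟩
  push Not at hemp
  obtain ⟨z, hz, hzlt⟩ := hemp
  obtain ⟨w, hw, hwr, hwmin⟩ := F.hop_ne hz
  have hM : F.d e w < 0.8 * (0.7 - F.Y e) - (1 + F.X e) := (hwmin z hz).trans_lt hzlt
  obtain ⟨hxw, hyw⟩ := F.ne_le hw
  have hMle := F.d_le_of_NE hw
  have hMX := F.abs_X_le_d e w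
  have hMY := F.abs_Y_le_d e w
  rw [abs_of_nonneg (by linarith)] at hMX hMY
  have hpw := F.reach_trans hpe hwr
  change F.reach p w (_ + F.d e w) at hpw
  change F.reach e w (F.d e w) at hwr
  have hland' : F.reach p w (1.4 - F.Y w + 9 * (1 + F.X w)) → -0.8 ≤ F.X w → F.Win p o :=
    fun h h' => win_of_landing hX hY h hpw (by linarith) h' (by linarith) (by linarith)
      (by linarith)
  -- Either `w` is higher than `u` and the invariant holds again, or the climb could continue.
  rcases F.east_trans (Or.inr hue) (Or.inl hw) with huw | huw
  · obtain ⟨hxuw, hyuw⟩ := F.ne_le huw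
    have hMsq := F.d_sq e w
    obtain ⟨hth, hcw⟩ := sweep_inequality (D := D) (θ := 0.8 * (0.7 - F.Y u) - (1 + F.X u))
      (ξ := F.X e - F.X u) (v := F.Y u - F.Y e) (r := F.X w - F.X u) (q := F.Y w - F.Y u)
      (M := F.d e w) (by linarith) (by linarith) (by linarith) (by linarith) (F.d_nonneg _ _)
      (fun h => by
        rw [← F.d_sq]
        exact pow_le_pow_left₀ h (hempty w huw) 2)
      (by rw [hMsq]; ring) (by linarith) hDe
    have hpw' : F.reach p w (1.4 - F.Y w + 9 * (1 + F.X w)) :=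
      F.reach_mono (F.reach_trans hreach (F.reach_trans her hwr)) (by linarith)
    -- At `w` the required radius of emptiness is not positive.
    by_cases hwX : -0.8 ≤ F.X w
    · exact Or.inl (hland' hpw' hwX)
    · exact Or.inr ⟨w, Or.inl huw, by linarith, not_le.1 hwX, by linarith, by linarith, hpw',
        fun x _ => by linarith [F.d_nonneg w x]⟩
  · have hwr' : F.reach u w (2 * D - (F.Y u - F.Y w) + (F.X w - F.X u)) :=
      F.reach_mono (F.reach_trans her hwr) (by linarith)
    have hDw : D ≤ (F.X w - F.X u) + (F.Y u - F.Y w) := (hmin w huw).trans (F.d_le_of_SE huw)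
    by_cases hwX : -0.8 ≤ F.X w
    · exact Or.inl (hland' (F.reach_mono (F.reach_trans hreach hwr') (by linarith)) hwX)
    · exact absurd ⟨huw, not_le.1 hwX, by linarith, by linarith, hwr'⟩ (hlast w (Or.inl hw))

/-- The sweep starts at `p`, if `p` is not near the north-western corner. -/
theorem win_or_exists_isSweepVertex_of_low [Finite V] (hX : F.X o = 0) (hY : F.Y o = 0)
    (hpX : F.X p = -1) (hpY : 0 ≤ F.Y p) (hpY' : F.Y p ≤ 0.7) :
    F.Win p o ∨ ∃ u, F.IsSweepVertex p u := by
  obtain ⟨t, ⟨htX, htX', htY, htY', htr⟩, hlast⟩ := F.exists_easternmost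
    (P := fun t => -1 ≤ F.X t ∧ F.X t < -0.8 ∧ F.Y p ≤ F.Y t ∧ F.Y t ≤ 0.7 ∧
      F.reach p t (F.Y t - F.Y p + (F.X t + 1)))
    (u := p) ⟨by linarith, by linarith, le_rfl, hpY', F.reach_mono (F.reach_refl p) (by linarith)⟩
  by_cases hemp : ∀ w, F.NE t w → 0.7 - F.Y t ≤ F.d t w
  · exact Or.inr ⟨t, htX, htX', by linarith, htY', F.reach_mono htr (by linarith),
      fun w hw => by linarith [hemp w hw]⟩
  push Not at hemp
  obtain ⟨z, hz, hzlt⟩ := hemp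
  obtain ⟨w, hw, hwr, hwmin⟩ := F.hop_ne hz
  have hM : F.d t w < 0.7 - F.Y t := (hwmin z hz).trans_lt hzlt
  obtain ⟨hxw, hyw⟩ := F.ne_le hw
  have hMle := F.d_le_of_NE hw
  have hMX := F.abs_X_le_d t w
  have hMY := F.abs_Y_le_d t w
  rw [abs_of_nonneg (by linarith)] at hMX hMY
  change F.reach t w (F.d t w) at hwr
  have hpw : F.reach p w (F.Y w - F.Y p + (F.X w + 1)) :=
    F.reach_mono (F.reach_trans htr hwr) (by linarith)
  by_cases hwX : -0.8 ≤ F.X w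
  · exact Or.inl (win_of_landing hX hY (F.reach_mono hpw (by linarith)) hpw (by linarith) hwX
      (by linarith) (by linarith) (by linarith))
  · exact absurd ⟨by linarith, not_le.1 hwX, by linarith, by linarith, hpw⟩ (hlast w (Or.inl hw))

/-- If `p` is near the north-western corner, then a chain of south-eastern hops leaves the corner;
after a reflection in the diagonal through the corner, it does so below the corner. -/
theorem win_or_exists_isSweepVertex_of_high [Finite V] (hX : F.X o = 0) (hY : F.Y o = 0)
    (hpX : F.X p = -1) (hpY : 0.7 < F.Y p) (hpY' : F.Y p ≤ 1) :
    F.Win p o ∨ (∃ u, F.IsSweepVertex p u) ∨ ∃ u, F.rot.refl.IsSweepVertex p u := by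
  obtain ⟨u, ⟨huX, huX', huY, huY', hur⟩, hlast⟩ := F.exists_easternmost
    (P := fun u => -1 ≤ F.X u ∧ F.X u < -0.7 ∧ 0.7 < F.Y u ∧ F.Y u ≤ 1 ∧
      F.reach p u (F.Y p - F.Y u + (F.X u + 1)))
    (u := p) ⟨by linarith, by linarith, hpY, hpY', F.reach_mono (F.reach_refl p) (by linarith)⟩
  have huo : F.SE u o := F.SE_of_lt (by linarith) (by linarith)
  obtain ⟨e, he, her, hemin⟩ := F.hop_se huo
  obtain ⟨hxe, hye⟩ := F.se_le he
  have hDle := F.d_le_of_SE he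
  have hDX := F.abs_X_le_d u e
  have hDY := F.abs_Y_le_d u e
  rw [abs_of_nonneg (by linarith)] at hDX
  rw [abs_of_nonpos (by linarith)] at hDY
  have hDsq := F.d_sq_le (hemin o huo)
  rw [← F.d_sq, hX, hY] at hDsq
  have hD : F.d u e ≤ 1.42 := by
    have : F.d u e ^ 2 ≤ 1.42 ^ 2 := by nlinarith
    exact le_of_sq_le_sq this (by norm_num)
  change F.reach u e (F.d u e) at her
  by_cases hYe : F.Y e ≤ 0.7
  · rcases win_or_exists_isSweepVertex hX hY huX (F.reach_mono hur (by linarith))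
      (fun w _ => by linarith [F.d_nonneg u w]) he her hemin (by linarith) (by linarith)
      (by linarith) hYe with h | ⟨u', -, h⟩
    · exact Or.inl h
    · exact Or.inr (Or.inl ⟨u', h⟩)
  by_cases hXe : F.X e < -0.7
  · exact absurd ⟨by linarith, hXe, not_le.1 hYe, by linarith,
      F.reach_mono (F.reach_trans hur her) (by linarith)⟩ (hlast e (Or.inr he))
  -- The hop leaves the corner at its east side: reflect in the diagonal.
  have hd : ∀ a b, F.rot.refl.d a b = F.d a b := fun a b => by
    simp only [d, coordDist, rot, refl]
    congr 1
    ring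
  rcases win_or_exists_isSweepVertex (F := F.rot.refl) (p := p) (o := o) (u := u) (e₁ := e)
    (by simpa [rot, refl] using hY) (by simpa [rot, refl] using hX)
    (by simp only [rot, refl]; linarith)
    (F.reach_mono hur (by simp only [rot, refl]; linarith))
    (fun w _ => by rw [hd]; simp only [rot, refl]; linarith [F.d_nonneg u w]) he
    (by rw [hd]; exact her) (fun x hx => by rw [hd, hd]; exact hemin x hx)
    (by rw [hd]; simp only [rot, refl]; linarith) (by simp only [rot, refl]; linarith)
    (by simp only [rot, refl]; linarith) (by simp only [rot, refl]; linarith) with h | ⟨u', -, h⟩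
  · exact Or.inl (F.win_of_rot (F.rot.win_of_refl h))
  · exact Or.inr (Or.inr ⟨u', h⟩)

end Frame

/-! ### The last vertex of the sweep -/

namespace Frame

variable {V : Type*} (F : Frame V)

/-- The last vertex `c` of the sweep, seen in a frame in which `o` lies south-east of it: the
south-eastern quadrant of `c` is empty up to a certain distance, and `c` itself is not yet close
enough to `o` for the contraction property. -/
structure IsTerminal (p o c : V) : Prop where
  X_o : F.X o = 0
  Y_o : F.Y o = 0
  le_X : -1 ≤ F.X c
  X_lt : F.X c < -0.8
  Y_nonneg : 0 ≤ F.Y c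
  Y_le : F.Y c ≤ 0.75
  se : F.SE c o
  reach : F.reach p c (1.4 + F.Y c + 9 * (1 + F.X c))
  cost : 11.89 * (1 + F.X c) < 1.4 + F.Y c
  empty : ∀ w, F.SE c w → 0.56 + 0.8 * F.Y c - (1 + F.X c) ≤ F.d c w

variable {F} {p o c : V}

/-- From a vertex `e` south-west of `o`, north-eastern hops lead to a last vertex `E` south-west of
`o` and south-east of `c`; the hop from `E` to `W` is no longer than the distance from `E` to
`o`. -/
theorem exists_northeast_chain [Finite V] (hX : F.X o = 0) (hY : F.Y o = 0) {e : V}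
    (he : F.SE c e) (heX : F.X e < 0) (heY : F.Y e < 0) :
    ∃ E W, F.SE c E ∧ F.X e ≤ F.X E ∧ F.X E < 0 ∧ F.Y e ≤ F.Y E ∧ F.Y E < 0 ∧
      F.reach e E (F.X E - F.X e + (F.Y E - F.Y e)) ∧ F.NE E W ∧ F.reach E W (F.d E W) ∧
      F.d E W ≤ F.d E o ∧ (F.NE c W ∨ F.SE c W ∧ (0 ≤ F.Y W ∨ 0 ≤ F.X W ∧ F.Y W < 0)) := by
  obtain ⟨E, ⟨hE, hEX, hEX', hEY, hEY', hEr⟩, hlast⟩ := F.exists_easternmost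
    (P := fun E => F.SE c E ∧ F.X e ≤ F.X E ∧ F.X E < 0 ∧ F.Y e ≤ F.Y E ∧ F.Y E < 0 ∧
      F.reach e E (F.X E - F.X e + (F.Y E - F.Y e))) (u := e)
    ⟨he, le_rfl, heX, le_rfl, heY, F.reach_mono (F.reach_refl e) (by linarith)⟩
  have hEo : F.NE E o := F.NE_of_lt (by linarith) (by linarith)
  obtain ⟨W, hW, hWr, hWmin⟩ := F.hop_ne hEo
  refine ⟨E, W, hE, hEX, hEX', hEY, hEY', hEr, hW, hWr, hWmin o hEo, ?_⟩
  rcases F.east_trans (Or.inr hE) (Or.inl hW) with h | h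
  · exact Or.inl h
  refine Or.inr ⟨h, ?_⟩
  by_contra! hcon
  obtain ⟨hxW, hyW⟩ := F.ne_le hW
  have hWX : F.X W < 0 := by
    by_contra! hWX
    linarith [hcon.2 hWX]
  exact hlast W (Or.inl hW) ⟨h, by linarith, hWX, by linarith, hcon.1,
    F.reach_mono (F.reach_trans hEr hWr) (by
      have := F.d_le_of_NE hW
      change _ + F.d E W ≤ _
      linarith)⟩

theorem d_sq_le_of_le_origin (hX : F.X o = 0) (hY : F.Y o = 0) {u v : V} (h : F.d u v ≤ F.d u o) :
    (F.X v - F.X u) ^ 2 + (F.Y v - F.Y u) ^ 2 ≤ F.X u ^ 2 + F.Y u ^ 2 := by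
  simpa [hX, hY] using F.d_sq_le h

namespace IsTerminal

variable (T : F.IsTerminal p o c)

include T

theorem le_d_sq {a : V} (ha : F.SE c a) :
    (0.56 + 0.8 * F.Y c - (1 + F.X c)) ^ 2 ≤ (F.X a - F.X c) ^ 2 + (F.Y a - F.Y c) ^ 2 := by
  rw [← F.d_sq]
  exact pow_le_pow_left₀ (by linarith [T.cost, T.Y_nonneg]) (T.empty a ha) 2

/-- A vertex south-east of `c` but not below `o` is close to `o`, since it is not close to `c`. -/
theorem neg_half_le_X {a : V} (ha : F.SE c a) (hYa : 0 ≤ F.Y a) : -0.5 ≤ F.X a := by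
  by_contra! h
  have h1 := T.le_d_sq ha
  obtain ⟨h2, h3⟩ := F.se_le ha
  have h4 := T.cost
  have h5 := T.Y_le
  have h6 := T.le_X
  nlinarith [mul_nonneg (sub_nonneg.2 h2) (sub_nonneg.2 h.le),
    mul_nonneg (hYa.trans h3) (sub_nonneg.2 h5), mul_nonneg (hYa.trans h3) hYa,
    mul_nonneg (hYa.trans h3) (sub_nonneg.2 h4.le)]

theorem win_of_shallow {a : V} {K n : ℝ} (ha : F.SE c a) (hYa : 0 ≤ F.Y a) (hn : 0.5 ≤ n)
    (hn' : n < 1) (hXa : F.X a ≤ n) (hYa' : F.Y a ≤ n) (hK : F.reach c a K)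
    (hc : 1.4 + F.Y c + 9 * (1 + F.X c) + K ≤ 20.89 * (1 - n)) : F.Win p o :=
  F.win_of_reach T.X_o T.Y_o (F.reach_trans T.reach hK) hXa (by linarith [T.neg_half_le_X ha hYa])
    hYa' (by linarith) hn' hc

end IsTerminal

/-- The hop from `c` to its south-eastern neighbour `e`, a chain of north-eastern hops from `e`
to `E`, and the hop from `E` to `W`, which is no longer than the distance from `E` to `o`. -/
structure IsFan (F : Frame V) (o c e E W : V) : Prop where
  se_e : F.SE c e
  reach_e : F.reach c e (F.d c e)
  min : ∀ x, F.SE c x → F.d c e ≤ F.d c x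
  se_E : F.SE c E
  X_le : F.X e ≤ F.X E
  X_neg : F.X E < 0
  Y_le : F.Y e ≤ F.Y E
  Y_neg : F.Y E < 0
  reach_E : F.reach c E (F.d c e + (F.X E - F.X e) + (F.Y E - F.Y e))
  ne_W : F.NE E W
  reach_W : F.reach c W (F.d c e + (F.X E - F.X e) + (F.Y E - F.Y e) + F.d E W)
  le_origin : F.d E W ≤ F.d E o

theorem IsTerminal.win_or_exists_fan [Finite V] (T : F.IsTerminal p o c) :
    F.Win p o ∨ ∃ e E W, F.IsFan o c e E W ∧ (F.NE c W ∨ 0 ≤ F.X W ∧ F.Y W < 0) := by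
  obtain ⟨e, he, her, hemin⟩ := F.hop_se T.se
  change F.reach c e (F.d c e) at her
  obtain ⟨hxe, hye⟩ := F.se_le he
  have hDX := F.abs_X_le_d c e
  have hDY := F.abs_Y_le_d c e
  rw [abs_of_nonneg (by linarith)] at hDX
  rw [abs_of_nonpos (by linarith)] at hDY
  have hle := d_sq_le_of_le_origin T.X_o T.Y_o (hemin o T.se)
  have hDsq := F.d_sq c e
  have hX1 := T.le_X
  have hX2 := T.X_lt
  have hY1 := T.Y_nonneg
  have hY2 := T.Y_le
  have hcost := T.cost
  have hD : F.d c e ≤ 1.25 := by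
    refine le_of_sq_le_sq (a := F.d c e) (b := 1.25) ?_ (by norm_num)
    nlinarith
  by_cases hYe : 0 ≤ F.Y e
  · refine Or.inl (T.win_of_shallow (n := 0.75) he hYe (by norm_num) (by norm_num) (by linarith)
      (by linarith) her (by linarith))
  have hXe : F.X e < 0 := by
    by_contra! h
    nlinarith
  obtain ⟨E, W, hE, hEX, hEX', hEY, hEY', hEr, hW, hWr, hWmin, hcase⟩ :=
    exists_northeast_chain T.X_o T.Y_o he hXe (not_le.1 hYe)
  have hcE := F.reach_mono (F.reach_trans her hEr)
    (show _ ≤ F.d c e + (F.X E - F.X e) + (F.Y E - F.Y e) by linarith)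
  have hcW := F.reach_trans hcE hWr
  have hfan : F.IsFan o c e E W := ⟨he, her, hemin, hE, hEX, hEX', hEY, hEY', hcE, hW, hcW, hWmin⟩
  rcases hcase with h | ⟨hcW', h | h⟩
  · exact Or.inr ⟨e, E, W, hfan, Or.inl h⟩
  · left
    have hsq := d_sq_le_of_le_origin T.X_o T.Y_o hWmin
    obtain ⟨hxW, hyW⟩ := F.ne_le hW
    have hWX : F.X W ≤ 0 := by
      by_contra! h'
      nlinarith
    have hEW := F.d_le_of_NE hW
    have hWY : F.Y W ≤ 0.65 := by
      by_contra! h'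
      obtain ⟨h2, h3⟩ := F.se_le hcW'
      have h4 : (F.X W - F.X c) ^ 2 ≤ (F.X c) ^ 2 := by nlinarith only [h2, hWX, hX2]
      have h5 : (F.Y W - F.Y c) ^ 2 ≤ 0.1 ^ 2 := by nlinarith only [h3, h', hY2]
      nlinarith only [T.le_d_sq hcW', h4, h5, hX1, hX2, h', h3]
    exact T.win_of_shallow (n := 0.65) hcW' h (by norm_num) (by norm_num) (by linarith) hWY hcW
      (by linarith)
  · exact Or.inr ⟨e, E, W, hfan, Or.inr h⟩

end Frame

/-! ### Fans that end north of `c` -/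

/-- The cost of a fan whose chain ends near the vertical line through `c`. Here `(ξ, -v)` leads from
`c` to `E`, `D` is the length of the first hop and `R` that of the last. -/
theorem fan_cost_le {D R ξ v y s : ℝ} (hDo : D ^ 2 ≤ s ^ 2 + y ^ 2)
    (hDE : D ^ 2 ≤ ξ ^ 2 + v ^ 2) (hR : R ^ 2 ≤ (s - ξ) ^ 2 + (v - y) ^ 2) (hs : s ≤ 1)
    (hs' : 0.8 ≤ s) (hy : 0 ≤ y) (hy' : y ≤ 0.75) (hyv : y ≤ v) (hvD : v ≤ D) (hξ : 0 ≤ ξ)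
    (hξ' : ξ ≤ 0.27) (hl : 0.44 ≤ D) : 2 * D - v + ξ + R ≤ 2.76 := by
  have hv : 0.34 ≤ v := by nlinarith only [hDE, hl, hξ, hξ', hyv, hy]
  have h1 : D ≤ v + 0.5 * ξ := by
    refine le_of_sq_le_sq (a := D) ?_ (by linarith)
    nlinarith only [hDE, mul_nonneg hξ (show 0 ≤ v - 0.75 * ξ by linarith)]
  have h2 : 2.4 * R ≤ 1.44 + ((s - ξ) ^ 2 + (v - y) ^ 2) := by
    nlinarith only [hR, sq_nonneg (R - 1.2)]
  have h3 : (s - ξ) ^ 2 ≤ 1 - 1.73 * ξ := by nlinarith only [hs, hs', hξ, hξ']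
  have h4 : D ≤ 1 + y / 3 := by
    refine le_of_sq_le_sq (a := D) ?_ (by linarith)
    nlinarith only [hDo, hs, hs', hy, hy']
  have h5 : (v - y) ^ 2 ≤ (1 - 2 * y / 3) ^ 2 := by nlinarith only [hyv, hvD, h4]
  nlinarith only [h1, h2, h3, h4, h5, hξ, hξ', hy, hy']

namespace Frame

variable {V : Type*} {F : Frame V} {p o c e E W : V}

namespace IsTerminal

variable (T : F.IsTerminal p o c) (hF : F.IsFan o c e E W)

include T hF

theorem fan_D_le : F.d c e ≤ 1.25 := by
  refine le_of_sq_le_sq (a := F.d c e) (b := 1.25) ?_ (by norm_num)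
  have h := d_sq_le_of_le_origin T.X_o T.Y_o (hF.min o T.se)
  rw [← F.d_sq] at h
  nlinarith only [h, T.le_X, T.X_lt, T.Y_le, T.Y_nonneg]

/-- The circle around `E` through `o` bounds the position of `W`. -/
theorem fan_circle : (F.X W - F.X E) ^ 2 + F.Y W ^ 2 + 2 * F.Y W * (- F.Y E) ≤ F.X E ^ 2 := by
  linarith [d_sq_le_of_le_origin T.X_o T.Y_o hF.le_origin]

theorem fan_north_bounds (hW : F.NE c W) : F.X W ≤ 0 ∧ F.Y W ≤ - F.X E := by
  have h := T.fan_circle hF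
  have h1 := (F.ne_le hW).2
  have h2 := T.Y_nonneg
  have h3 := hF.X_neg
  have h4 := (F.ne_le hF.ne_W).1
  have h5 : 0 ≤ 2 * F.Y W * (- F.Y E) := by nlinarith only [h1, h2, hF.Y_neg]
  exact ⟨by nlinarith only [h, h3, h4, h5, sq_nonneg (F.Y W)],
    by nlinarith only [h, h3, h5, sq_nonneg (F.X W - F.X E), h1, h2]⟩

/-- If `E` is not near the vertical line through `c`, then `W` is close to `o`. -/
theorem win_of_fan_wide (hW : F.NE c W) (hE : 0.27 ≤ F.X E - F.X c) : F.Win p o := by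
  obtain ⟨h1, h2⟩ := T.fan_north_bounds hF hW
  have h3 := T.fan_D_le hF
  have h4 := F.d_le_of_NE hF.ne_W
  have h5 := F.abs_Y_le_d c e
  have h6 := (F.se_le hF.se_e).1
  have h7 := (F.se_le hF.se_E).1
  have h8 := (F.ne_le hF.ne_W).1
  have h9 := T.Y_nonneg
  have h10 := (F.ne_le hW).2
  have h11 := T.le_X
  rw [abs_of_nonpos (by linarith [hF.Y_le, hF.Y_neg, (F.se_le hF.se_e).2])] at h5
  exact F.win_of_reach (n := - F.X E) T.X_o T.Y_o (F.reach_trans T.reach hF.reach_W)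
    (by linarith [hF.X_neg]) (by linarith) h2 (by linarith [hF.X_neg]) (by linarith) (by linarith)

theorem fan_reach_le (hE : F.X E - F.X c ≤ 0.27) : F.reach c W 2.76 := by
  refine F.reach_mono hF.reach_W ?_
  have h := d_sq_le_of_le_origin T.X_o T.Y_o (hF.min o T.se)
  have h' := d_sq_le_of_le_origin T.X_o T.Y_o hF.le_origin
  have h'' := F.d_sq_le (hF.min E hF.se_E)
  rw [← F.d_sq] at h h' h''
  have h5 := F.abs_Y_le_d c e
  have h6 := (F.se_le hF.se_e).1
  have h7 := (F.se_le hF.se_E).1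
  have h8 := T.Y_nonneg
  rw [abs_of_nonpos (by linarith [hF.Y_le, hF.Y_neg, (F.se_le hF.se_e).2])] at h5
  have := fan_cost_le (D := F.d c e) (R := F.d E W) (ξ := F.X E - F.X c) (v := F.Y c - F.Y E)
    (y := F.Y c) (s := - F.X c) (by linarith) (by linarith) (by linarith)
    (by linarith [T.le_X]) (by linarith [T.X_lt]) h8 T.Y_le (by linarith [hF.Y_neg])
    (by linarith [hF.Y_le]) (by linarith) hE
    (by linarith [T.empty e hF.se_e, T.cost])
  linarith

theorem fan_Y_le (hE : F.X E - F.X c ≤ 0.27) : F.Y W ≤ 0.68 := by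
  by_contra! hcon
  have h1 := T.fan_circle hF
  have h2 := T.le_d_sq hF.se_E
  have h3 := (F.se_le hF.se_E).1
  have h4 := hF.Y_neg
  have h5 := T.le_X
  have h6 := T.X_lt
  have h7 := T.Y_nonneg
  have h8 := T.Y_le
  have h9 := hF.X_neg
  have h10 : 0.4624 + 1.36 * (- F.Y E) ≤ F.X E ^ 2 := by
    nlinarith only [h1, sq_nonneg (F.X W - F.X E), hcon, h4]
  have h11 : F.X E ^ 2 ≤ 1 - 1.53 * (1 + F.X E) := by nlinarith only [h3, hE, h5, h6, h9]
  have h12 : - F.Y E ≤ 0.3954 - 1.125 * (1 + F.X E) := by linarith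
  have h13 : (F.Y E - F.Y c) ^ 2 ≤ (F.Y c + 0.3954 - 1.125 * (1 + F.X E)) ^ 2 := by
    nlinarith only [h12, h4, h7]
  have h14 : F.Y c + 0.3954 - 1.125 * (1 + F.X E) + 1.125 * (F.X E - F.X c) + 0.01 ≤
      0.56 + 0.8 * F.Y c - (1 + F.X c) := by linarith
  have h15 : 0 < F.Y c + 0.3954 - 1.125 * (1 + F.X E) := by linarith
  have h16 := pow_le_pow_left₀ (by linarith) h14 2
  nlinarith only [h2, h13, h16, h15, h3]

/-- If `W` is not near the vertical line through `c`, then it is close to `o`. -/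
theorem win_of_fan_north (hW : F.NE c W) (hE : F.X E - F.X c ≤ 0.27) {K : ℝ}
    (hK0 : 0 ≤ K) (hK : F.reach p c K)
    (hp : K + 2.76 ≤ 20.89 * (1 + F.X W)) (hK' : K ≤ 1.4 + F.Y c + 9 * (1 + F.X c)) :
    F.Win p o := by
  obtain ⟨h1, h2⟩ := T.fan_north_bounds hF hW
  have h3 := T.fan_Y_le hF hE
  have h4 := (F.ne_le hW).2
  have h5 := T.Y_nonneg
  have h6 := F.reach_trans hK (T.fan_reach_le hF hE)
  have h7 := T.cost
  have h8 := T.Y_le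
  rcases le_total (F.X W) (-0.68) with h | h
  · exact F.win_of_reach (n := - F.X W) T.X_o T.Y_o h6 (by linarith) (by linarith) (by linarith)
      (by linarith) (by linarith) (by linarith)
  · exact F.win_of_reach (n := 0.68) T.X_o T.Y_o h6 (by linarith) (by linarith) (by linarith)
      (by linarith) (by norm_num) (by linarith)

end IsTerminal

end Frame

/-- If `(ξ, -v)` leads from `c` to `E` and `(r, q)` to `W`, then the circle around `E` through `o`
confines `W` as if `E` were vertically below `c`, at distance `l`. -/
theorem north_constraint {a l r q v ξ s y t : ℝ} (hl : 0.44 ≤ l) (ht : t ≤ 1) (hv : 0 ≤ v)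
    (hξ : 0 ≤ ξ) (hr : ξ ≤ r) (hr' : r ≤ 0.24) (hs : 0.8 ≤ s) (hlE : l ^ 2 ≤ ξ ^ 2 + v ^ 2)
    (ha : a ^ 2 ≤ r ^ 2 + q ^ 2)
    (h : r ^ 2 + q ^ 2 + 2 * v * t + 2 * ξ * (s - r) ≤ s ^ 2 + y ^ 2) (ht0 : 0 ≤ t) :
    a ^ 2 + 2 * l * t ≤ s ^ 2 + y ^ 2 := by
  suffices (l - v) * t ≤ ξ * (s - r) by linarith
  by_contra! hcon
  have h1 : (l - v) * (l + v) ≤ ξ ^ 2 := by linarith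
  have h2 : ξ * (s - r) * (l + v) < ξ ^ 2 * t := by
    calc ξ * (s - r) * (l + v) < (l - v) * t * (l + v) := by gcongr
      _ = (l - v) * (l + v) * t := by ring
      _ ≤ ξ ^ 2 * t := by gcongr
  have h3 : 0.56 * 0.44 ≤ (s - r) * (l + v) := by
    apply mul_le_mul <;> linarith
  have h4 : ξ * t ≤ 0.24 * 1 := mul_le_mul (by linarith) ht ht0 (by norm_num)
  nlinarith only [h2, mul_nonneg hξ (show 0 ≤ (s - r) * (l + v) - ξ * t by linarith)]

/-- The numerical contradiction behind the first of the two cases in which the terminal vertex lies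
north-west of `o`. -/
theorem false_of_north_upper {δ y q r : ℝ} (hδ : 0 ≤ δ) (hδ' : 11.89 * δ ≤ 1.4 - y) (hy : 0 ≤ y)
    (hy' : y ≤ 0.292) (hq : 0 ≤ q) (hr : 0 ≤ r) (hr' : 20.89 * r ≤ 4.16 - y - 11.89 * δ)
    (ha : (0.56 - 0.8 * y - δ) ^ 2 ≤ r ^ 2 + q ^ 2)
    (h : (0.56 - 0.8 * y - δ) ^ 2 + 2 * (0.75 + y) * (y + q) ≤ (1 - δ) ^ 2 + y ^ 2) : False := by
  have h1 : q ≤ 0.459 - 0.95 * y - 0.58 * δ := by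
    by_contra! hcon
    nlinarith only [h, hcon, hδ, hδ', hy, hy', mul_nonneg hy hδ,
      mul_nonneg hy (sub_nonneg.2 hy')]
  have h2 : r ≤ 0.1992 - 0.0478 * y - 0.569 * δ := by linarith
  have h3 : q ^ 2 ≤ (0.459 - 0.95 * y - 0.58 * δ) ^ 2 := pow_le_pow_left₀ hq h1 2
  have h4 : r ^ 2 ≤ (0.1992 - 0.0478 * y - 0.569 * δ) ^ 2 := pow_le_pow_left₀ hr h2 2
  nlinarith only [ha, h3, h4, hδ, hδ', hy, hy', mul_nonneg hy hδ, mul_nonneg hy (sub_nonneg.2 hy')]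

/-- The numerical contradiction behind the second case, for a terminal vertex that is not too far
from the horizontal line through `o`. -/
theorem false_of_north_lower {δ y q r : ℝ} (hδ : 0 ≤ δ) (hδ' : 11.89 * δ ≤ 1.4 + y) (hy : 0 ≤ y)
    (hy' : y ≤ 0.48) (hq : 0 ≤ q) (hq' : y + q ≤ 0.68) (hr : 0 ≤ r)
    (hr' : 20.89 * r ≤ 4.16 + y - 11.89 * δ) (ha : (0.75 - y) ^ 2 ≤ r ^ 2 + q ^ 2)
    (h : (0.75 - y) ^ 2 + 2 * (0.56 + 0.8 * y - δ) * (y + q) ≤ (1 - δ) ^ 2 + y ^ 2) : False := by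
  have h0 : (0.75 - y) ^ 2 + 2 * (0.56 + 0.8 * y) * (y + q) ≤ 1 + y ^ 2 := by
    nlinarith only [h, hδ, hδ', hy', hq']
  have h1 : q ≤ 0.4795 - 0.72 * y := by
    by_contra! hcon
    nlinarith only [h0, hcon, hy, hy', mul_nonneg hy (sub_nonneg.2 hy'), sq_nonneg (y - 0.48)]
  have h2 : r ≤ 0.2223 := by linarith
  have h3 : q ^ 2 ≤ (0.4795 - 0.72 * y) ^ 2 := pow_le_pow_left₀ hq h1 2
  have h4 : r ^ 2 ≤ 0.2223 ^ 2 := pow_le_pow_left₀ hr h2 2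
  nlinarith only [ha, h3, h4, hy, hy']

namespace Frame

variable {V : Type*} {F : Frame V} {p o c e E W : V}

namespace IsTerminal

variable (T : F.IsTerminal p o c) (hF : F.IsFan o c e E W)

include T hF

/-- If `W` is north-east of `c` and close to the vertical line through `c`, then the circle around
`E` through `o` leaves little room for it. -/
theorem fan_constraint (hW : F.NE c W) (hp : F.X W - F.X c ≤ 0.24) {a l : ℝ} (hl : 0.44 ≤ l)
    (hlE : l ≤ F.d c E) (ha : 0 ≤ a) (haW : a ≤ F.d c W) :
    a ^ 2 + 2 * l * F.Y W ≤ F.X c ^ 2 + F.Y c ^ 2 := by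
  have h1 := pow_le_pow_left₀ (by linarith) hlE 2
  have h2 := pow_le_pow_left₀ ha haW 2
  have h3 := T.fan_circle hF
  have h4 := (F.se_le hF.se_E).1
  have h5 := (F.ne_le hF.ne_W).1
  rw [F.d_sq] at h1 h2
  have := north_constraint (a := a) (l := l) (r := F.X W - F.X c) (q := F.Y W - F.Y c)
    (v := F.Y c - F.Y E) (ξ := F.X E - F.X c) (s := - F.X c) (y := F.Y c) (t := F.Y W) hl
    (by linarith [T.fan_Y_le hF (by linarith)]) (by linarith [hF.Y_neg, T.Y_nonneg]) (by linarith)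
    (by linarith) hp (by linarith [T.X_lt]) (by linarith) h2 (by linarith)
    (by linarith [(F.ne_le hW).2, T.Y_nonneg])
  linarith

/-- The case in which `o` is south-east of the last vertex of the sweep in the original frame. -/
theorem win_of_fan_north_upper (hW : F.NE c W)
    (hr : F.reach p c (1.4 - F.Y c + 9 * (1 + F.X c))) (hcost : 11.89 * (1 + F.X c) < 1.4 - F.Y c)
    (hse : ∀ w, F.SE c w → 0.75 + F.Y c ≤ F.d c w)
    (hne : ∀ w, F.NE c w → 0.56 - 0.8 * F.Y c - (1 + F.X c) ≤ F.d c w) : F.Win p o := by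
  have hX := T.le_X
  have hY := T.Y_nonneg
  rcases le_total 0.27 (F.X E - F.X c) with hE | hE
  · exact T.win_of_fan_wide hF hW hE
  rcases le_total (1.4 - F.Y c + 9 * (1 + F.X c) + 2.76) (20.89 * (1 + F.X W)) with h | h
  · exact T.win_of_fan_north hF hW hE (by linarith [T.Y_le]) hr h (by linarith)
  exfalso
  have hy : F.Y c ≤ 0.292 := by
    have h1 := pow_le_pow_left₀ (by linarith) (hse o T.se) 2
    rw [F.d_sq, T.X_o, T.Y_o] at h1
    nlinarith only [h1, hX, T.X_lt]
  obtain ⟨h1, h2⟩ := F.ne_le hW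
  have hc := T.fan_constraint hF hW (a := 0.56 - 0.8 * F.Y c - (1 + F.X c)) (l := 0.75 + F.Y c)
    (by linarith) (by linarith) (hse E hF.se_E) (by linarith) (hne W hW)
  have ha := pow_le_pow_left₀ (by linarith) (hne W hW) 2
  rw [F.d_sq] at ha
  exact false_of_north_upper (δ := 1 + F.X c) (y := F.Y c) (q := F.Y W - F.Y c)
    (r := F.X W - F.X c) (by linarith) (by linarith) hY hy (by linarith) (by linarith)
    (by linarith) ha (by linarith)

/-- The case in which the frame has been reflected, so that the north-eastern quadrant of `c` is the
one in which the sweep has stopped; here `c` is not far above `o`. -/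
theorem win_of_fan_north_lower (hW : F.NE c W) (hy : F.Y c ≤ 0.48)
    (hne : ∀ w, F.NE c w → 0.75 - F.Y c ≤ F.d c w) : F.Win p o := by
  have hX := T.le_X
  have hY := T.Y_nonneg
  have hcost := T.cost
  rcases le_total 0.27 (F.X E - F.X c) with hE | hE
  · exact T.win_of_fan_wide hF hW hE
  rcases le_total (1.4 + F.Y c + 9 * (1 + F.X c) + 2.76) (20.89 * (1 + F.X W)) with h | h
  · exact T.win_of_fan_north hF hW hE (by linarith) T.reach h le_rfl
  exfalso
  obtain ⟨h1, h2⟩ := F.ne_le hW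
  have hc := T.fan_constraint hF hW (a := 0.75 - F.Y c) (by linarith) (by linarith)
    (T.empty E hF.se_E) (by linarith) (hne W hW)
  have ha := pow_le_pow_left₀ (by linarith) (hne W hW) 2
  rw [F.d_sq] at ha
  exact false_of_north_lower (δ := 1 + F.X c) (y := F.Y c) (q := F.Y W - F.Y c)
    (r := F.X W - F.X c) (by linarith) (by linarith) hY hy (by linarith)
    (by linarith [T.fan_Y_le hF hE]) (by linarith) (by linarith) ha (by linarith)

end IsTerminal

end Frame

/-! ### Fans that end south-east of `o` -/

/-- Bounds for the next hop `(x', y')` of a chain that has descended from the origin to `(x, y)`, if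
the hop is not longer than the distance from `(x, y)` to `(u, w)`. -/
theorem descent_bounds {s u w x y x' y' : ℝ} (hs : 0.857 ≤ s) (hu : -s ≤ u) (hu' : u ≤ -0.37 * s)
    (hw : 0.78 * s ≤ - w) (hw' : - w ≤ s) (huw : w ^ 2 + (u + s) ^ 2 ≤ s ^ 2) (hx : -0.27 * s < x)
    (hx' : x ≤ 0) (hy : -0.23 * s < y) (hy' : y ≤ 0)
    (h : (x' - x) ^ 2 + (y' - y) ^ 2 ≤ (u - x) ^ 2 + (w - y) ^ 2) :
    - x' ≤ 1.69 * s ∧ - y' ≤ 1.493 * s ∧ - x' - y' ≤ 2.5 * s ∧ - x' ≤ - u + 0.71 * s := by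
  have h1 : (u - x) ^ 2 ≤ s ^ 2 := by nlinarith only [hu', hx, hx', hu, hs]
  have h2 : (w - y) ^ 2 ≤ (s + y) ^ 2 := by nlinarith only [hw, hw', hy, hy']
  refine ⟨?_, ?_, ?_, ?_⟩
  · have : - (x' - x) ≤ 1.42 * s := by
      by_contra! hcon
      nlinarith only [hcon, h, h1, h2, hs, hy, hy', sq_nonneg (y' - y)]
    linarith
  · by_contra! hcon
    have : (1.493 * s + y) ^ 2 ≤ (y' - y) ^ 2 := by nlinarith only [hcon, hy, hs]
    nlinarith only [this, h, h1, h2, hs, hy, sq_nonneg (x' - x)]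
  · have : - (x' - x) - (y' - y) ≤ 2 * s := by
      by_contra! hcon
      nlinarith only [hcon, h, h1, h2, hs, hy, hy', sq_nonneg ((x' - x) - (y' - y))]
    linarith
  · by_contra! hcon
    have h3 : (0.71 * s - u + x) ^ 2 ≤ (x' - x) ^ 2 := by nlinarith only [hcon, hx, hu', hs]
    have h4 : (w - y) ^ 2 ≤ w ^ 2 := by nlinarith only [hw, hy, hy']
    nlinarith only [h3, h4, h, huw, hx, hs, sq_nonneg (y' - y), sq_nonneg (u + 0.29 * s)]

namespace Frame

variable {V : Type*} {F : Frame V} {p o c e E W : V}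

/-- The contraction property holds if vertices `a` and `b` near each other are reached cheaply from
`p` and `o`. -/
theorem win_of_pair {a b : V} {K K' n : ℝ} (h : F.reach p a K) (h' : F.reach o b K')
    (h1 : F.X a - F.X b ≤ n) (h2 : F.X b - F.X a ≤ n) (h3 : F.Y a - F.Y b ≤ n)
    (h4 : F.Y b - F.Y a ≤ n) (hn : n < 1) (hc : K + K' ≤ 20.89 * (1 - n)) : F.Win p o :=
  ⟨a, b, K, K', n, h, h', abs_sub_le_iff.2 ⟨h1, h2⟩, abs_sub_le_iff.2 ⟨h3, h4⟩, hn, hc⟩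

/-- From `o`, south-western hops lead towards `e` until they leave a box whose size is a
proportion of `s`. -/
theorem exists_southwest_chain [Finite V] (hX : F.X o = 0) (hY : F.Y o = 0) {s : ℝ} (hs : 0 < s)
    (heX : F.X e ≤ -0.27 * s) (heY : F.Y e ≤ -0.23 * s) :
    ∃ z z', -0.27 * s < F.X z ∧ F.X z ≤ 0 ∧ -0.23 * s < F.Y z ∧ F.Y z ≤ 0 ∧ F.X z' ≤ F.X z ∧
      F.Y z' ≤ F.Y z ∧ F.reach o z' (- F.X z' - F.Y z') ∧
      (F.X z' - F.X z) ^ 2 + (F.Y z' - F.Y z) ^ 2 ≤ (F.X e - F.X z) ^ 2 + (F.Y e - F.Y z) ^ 2 ∧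
      (-0.23 * s < F.Y z' → F.X z' ≤ -0.27 * s) := by
  obtain ⟨z, ⟨h1, h2, h3, h4, h5⟩, hlast⟩ := F.exists_westernmost
    (P := fun z => -0.27 * s < F.X z ∧ F.X z ≤ 0 ∧ -0.23 * s < F.Y z ∧ F.Y z ≤ 0 ∧
      F.reach o z (- F.X z - F.Y z)) (u := o)
    ⟨by linarith, hX.le, by linarith, hY.le, F.reach_mono (F.reach_refl o) (by linarith)⟩
  have hez : F.NE e z := F.NE_of_lt (by linarith) (by linarith)
  obtain ⟨z', hz', hr, hmin⟩ := F.hop_sw hez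
  obtain ⟨h6, h7⟩ := F.ne_le hz'
  have h8 := F.d_le_of_NE hz'
  rw [F.d_comm] at h8
  have h9 : F.reach o z' (- F.X z' - F.Y z') := by
    refine F.reach_mono (F.reach_trans h5 hr) ?_
    change _ + F.d z z' ≤ _
    linarith
  refine ⟨z, z', h1, h2, h3, h4, h6, h7, h9, F.d_sq_le (hmin e hez), fun h => ?_⟩
  by_contra! h'
  exact hlast z' (Or.inl hz') ⟨h', by linarith, h, by linarith, h9⟩

theorem IsFan.le_D (hF : F.IsFan o c e E W) : F.Y c - F.Y e ≤ F.d c e := by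
  have := F.abs_Y_le_d c e
  rwa [abs_of_nonpos (by linarith [(F.se_le hF.se_e).2]), neg_sub] at this

namespace IsTerminal

variable (T : F.IsTerminal p o c) (hF : F.IsFan o c e E W)

include T hF

/-- The first hop is not longer than the distance from `c` to `o`; this bounds the depth of `e`. -/
theorem fan_depth : F.Y e ^ 2 + 2 * F.Y c * (- F.Y e) + (F.X e - F.X c) ^ 2 ≤ F.X c ^ 2 := by
  linarith [d_sq_le_of_le_origin T.X_o T.Y_o (hF.min o T.se)]

theorem fan_D_sq_le : F.d c e ^ 2 ≤ F.X c ^ 2 + F.Y c ^ 2 := by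
  rw [F.d_sq]
  exact d_sq_le_of_le_origin T.X_o T.Y_o (hF.min o T.se)

theorem fan_depth_le : - F.Y e ≤ - F.X c := by
  have h := T.fan_depth hF
  have h1 : 0 ≤ 2 * F.Y c * (- F.Y e) := by
    nlinarith only [T.Y_nonneg, hF.Y_le, hF.Y_neg]
  have h2 := T.X_lt
  nlinarith only [h, h1, h2, sq_nonneg (F.X e - F.X c)]

theorem fan_south_sub_le (hWY : F.Y W < 0) : F.X W + F.Y W ≤ 0.42 * (- F.Y E) := by
  by_contra! hcon
  have h1 := d_sq_le_of_le_origin T.X_o T.Y_o hF.le_origin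
  have h2 := hF.X_neg
  have h3 := hF.Y_neg
  have h4 : (- F.Y W + 0.42 * (- F.Y E)) - F.X E ≤ F.X W - F.X E := by linarith
  have h6 : (- F.Y W + 0.42 * (- F.Y E) - F.X E) ^ 2 ≤ (F.X W - F.X E) ^ 2 :=
    pow_le_pow_left₀ (by linarith) h4 2
  nlinarith only [h1, h6, h2, h3, hWY, mul_pos_of_neg_of_neg h2 h3,
    mul_nonneg_of_nonpos_of_nonpos h2.le hWY.le, sq_nonneg (F.Y W - 0.29 * F.Y E)]

theorem fan_south_X_le : F.X W ≤ - F.Y E := by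
  by_contra! hcon
  nlinarith only [d_sq_le_of_le_origin T.X_o T.Y_o hF.le_origin, hF.X_neg, hF.Y_neg, hcon,
    sq_nonneg (F.Y W - F.Y E)]

/-- If `c` is well above `o`, then `e` is not far below `o`, and neither is `W`. -/
theorem win_of_fan_south_of_high (hWX : 0 ≤ F.X W) (hWY : F.Y W < 0) (hy : 0.3 ≤ F.Y c) :
    F.Win p o := by
  have h1 := T.le_X
  have h2 := T.X_lt
  have h3 := T.Y_le
  have h4 := T.fan_D_sq_le hF
  have h5 := hF.le_D
  have h6 := T.fan_south_sub_le hF hWY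
  have h7 := T.fan_south_X_le hF
  have h8 := F.d_le_of_NE hF.ne_W
  have h9 := (F.ne_le hF.ne_W).2
  have h10 := (F.se_le hF.se_e).1
  have h11 := hF.Y_le
  have hD : F.d c e ≤ 1.25 - 0.7 * (1 + F.X c) := by
    refine le_of_sq_le_sq (a := F.d c e) ?_ (by linarith)
    nlinarith only [h4, h1, h2, h3, hy]
  have hdepth : - F.Y e ≤ 0.745 * (- F.X c) := by
    by_contra! hcon
    nlinarith only [T.fan_depth hF, hcon, hy, h1, h2, sq_nonneg (F.X e - F.X c)]
  exact F.win_of_reach (n := 0.745 * (- F.X c)) T.X_o T.Y_o (F.reach_trans T.reach hF.reach_W)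
    (by linarith) (by linarith) (by linarith) (by linarith) (by linarith) (by linarith)

set_option maxHeartbeats 400000 in
/-- If `W` is not close to `o`, then the vertices of the fan are compared with the end `z'` of a
south-western chain from `o`. -/
theorem win_of_fan_south_of_low [Finite V] (hWX : 0 ≤ F.X W) (hWY : F.Y W < 0)
    (hy : F.Y c ≤ 0.3) : F.Win p o := by
  have h1 := T.le_X
  have h2 := T.X_lt
  have h3 := T.Y_nonneg
  have hcost := T.cost
  have h4 := T.fan_D_sq_le hF
  have h5 := hF.le_D
  have h6 := T.fan_south_sub_le hF hWY
  have h7 := T.fan_south_X_le hF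
  have h8 := F.d_le_of_NE hF.ne_W
  have h9 := (F.ne_le hF.ne_W).2
  have h10 := (F.se_le hF.se_e).1
  have h11 := hF.Y_le
  have h12 := T.fan_depth hF
  have h13 := T.fan_depth_le hF
  have h14 := d_sq_le_of_le_origin T.X_o T.Y_o hF.le_origin
  have h15 := hF.X_le
  have h16 := hF.X_neg
  have h17 := hF.Y_neg
  obtain ⟨s, hs⟩ : ∃ s, s = - F.X c := ⟨_, rfl⟩
  have hc : F.X c = - s := by linarith
  rw [hc] at h1 h2 hcost h4 h10 h12
  rw [hc, neg_neg] at h13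
  have hs' : 0.857 ≤ s := by linarith
  have hD : F.d c e ≤ s + 0.0525 := by
    refine le_of_sq_le_sq (a := F.d c e) ?_ (by linarith)
    nlinarith only [h4, hs', hy, h3]
  -- The costs of `W`, `E` and `e`.
  have hrW : F.reach p W (4.505 + 6 * (1 - s) + F.X W + F.Y W) :=
    F.reach_mono (F.reach_trans T.reach hF.reach_W) (by linarith)
  have hrE : F.reach p E (4.505 + 6 * (1 - s) + F.X E + F.Y E) :=
    F.reach_mono (F.reach_trans T.reach hF.reach_E) (by linarith)
  have hre : F.reach p e (2.7525 + 8 * (1 - s)) :=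
    F.reach_mono (F.reach_trans T.reach hF.reach_e) (by linarith)
  by_cases hW : - F.Y W ≤ 0.78 * s ∧ F.X W ≤ 0.74 * s
  · rcases le_total (- F.Y W) (0.74 * s) with h | h
    · exact F.win_of_reach (n := 0.74 * s) T.X_o T.Y_o hrW (by linarith) (by linarith)
        (by linarith) (by linarith) (by linarith) (by linarith)
    · exact F.win_of_reach (n := 0.78 * s) T.X_o T.Y_o hrW (by linarith) (by linarith)
        (by linarith) (by linarith) (by linarith) (by linarith)
  -- A hop that ends far east of `o` started almost below `o`.
  have hwide : 0.74 * s < F.X W → - F.X E ≤ 0.306 * s := fun h => by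
    by_contra! hcon
    have h18 := pow_le_pow_left₀ (by linarith) (show - F.Y E ≤ s by linarith) 2
    nlinarith only [h14, h, hcon, h18, hs', sq_nonneg (F.Y W - F.Y E)]
  by_cases hE : 0.74 * s < F.X W ∧ - F.Y E ≤ 0.8 * s
  · have := hwide hE.1
    exact F.win_of_reach (n := 0.8 * s) T.X_o T.Y_o hrE (by linarith) (by linarith)
      (by linarith) (by linarith) (by linarith) (by linarith)
  -- Now `E` lies far below `o`, and so does `e`; a chain from `o` descends to meet the fan.
  have hyE : 0.78 * s ≤ - F.Y E := by
    by_contra! hcon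
    refine hW ⟨by linarith, ?_⟩
    by_contra! h
    exact hE ⟨h, by linarith⟩
  have h18 : F.Y e ^ 2 + (F.X e + s) ^ 2 ≤ s ^ 2 := by
    nlinarith only [h12, h3, hyE, h11, hs']
  have hxe : F.X e ≤ -0.37 * s := by
    by_contra! hcon
    nlinarith only [h18, hcon, hyE, h11, hs']
  obtain ⟨z, z', hz1, hz2, hz3, hz4, hz5, hz6, hrz, hzsq, hbox⟩ :=
    F.exists_southwest_chain (e := e) (s := s) T.X_o T.Y_o (by linarith) (by linarith)
      (by linarith)
  obtain ⟨hm, hk, hmk, hme⟩ := descent_bounds hs' h10 hxe (by linarith) h13 h18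
    hz1 hz2 hz3 hz4 hzsq
  clear h4 h12 h18 hzsq
  -- The pairs to try are `c`, `z'`; `e`, `z'`; `W`, `z'`; and `E`, `z'`.
  rcases lt_or_ge (-0.23 * s) (F.Y z') with hkz | hkz
  · have := hbox hkz
    exact F.win_of_pair (n := 0.73 * s) T.reach hrz (by linarith) (by linarith) (by linarith)
      (by linarith) (by linarith) (by linarith)
  by_cases hez : - F.X e + F.X z' ≤ 0.71 * s
  · rcases le_total (- F.Y z') (0.287 * s) with h | h
    · exact F.win_of_pair (n := s + F.Y z') hre hrz (by linarith) (by linarith) (by linarith)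
        (by linarith) (by linarith) (by linarith)
    · exact F.win_of_pair (n := 0.713 * s) hre hrz (by linarith) (by linarith) (by linarith)
        (by linarith) (by linarith) (by linarith)
  have hmz : - F.X z' ≤ 0.29 * s := by linarith
  by_cases hWz : F.X W ≤ 0.74 * s ∧ F.X W - F.X z' ≤ 0.71 * s
  · have hb : 0.78 * s ≤ - F.Y W := by
      by_contra! h
      exact hW ⟨h.le, hWz.1⟩
    rcases le_total (F.Y z' - F.Y W) (0.713 * s) with h | h
    · exact F.win_of_pair (n := 0.713 * s) hrW hrz (by linarith) (by linarith) (by linarith)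
        (by linarith) (by linarith) (by linarith)
    · exact F.win_of_pair (n := 0.77 * s) hrW hrz (by linarith) (by linarith) (by linarith)
        (by linarith) (by linarith) (by linarith)
  have hEz : - F.X E + F.X z' ≤ 0.71 * s := by
    by_cases h : 0.74 * s < F.X W
    · linarith [hwide h]
    · have h21 : 0.71 * s < F.X W - F.X z' := by
        by_contra! h'
        exact hWz ⟨not_lt.1 h, h'⟩
      have h22 : F.X W - F.X E ≤ 1.42 * s := by
        by_contra! hcon
        have h23 := pow_le_pow_left₀ (by linarith) (show - F.Y E ≤ s by linarith) 2
        have h24 := pow_le_pow_left₀ (by linarith) (show - F.X E ≤ s by linarith) 2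
        nlinarith only [h14, hcon, h23, h24, hs', sq_nonneg (F.Y W - F.Y E)]
      linarith
  rcases le_total (F.Y z' - F.Y E) (0.713 * s) with h | h
  · exact F.win_of_pair (n := 0.713 * s) hrE hrz (by linarith) (by linarith) (by linarith)
      (by linarith) (by linarith) (by linarith)
  · exact F.win_of_pair (n := 0.77 * s) hrE hrz (by linarith) (by linarith) (by linarith)
      (by linarith) (by linarith) (by linarith)

end IsTerminal

end Frame

/-! ### A second fan -/

/-- A bound for the height `t` of the end of the first fan. -/
theorem north_height_le {δ y t : ℝ} (hδ : 0 ≤ δ) (hδ' : δ ≤ 0.2) (hy : 0.48 ≤ y) (hyt : y ≤ t)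
    (ht : t ≤ 0.68)
    (h : (0.75 - y) ^ 2 + 2 * (0.56 + 0.8 * y - δ) * t ≤ (1 - δ) ^ 2 + y ^ 2) :
    t ≤ 0.66 - 0.3 * δ := by
  by_contra! hcon
  nlinarith only [hcon, h, hδ, hδ', hy, hyt, ht,
    mul_nonneg (show 0 ≤ 1.12 + 1.6 * y - 2 * δ by linarith) (sub_nonneg.2 hcon.le),
    mul_nonneg hδ (sub_nonneg.2 hyt)]

/-- A bound for the horizontal offset `r` of the end of the first fan: it lies outside the empty
part of the north-eastern quadrant of `c`, but not high above `c`. -/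
theorem north_offset_ge {δ y q r : ℝ} (hδ : 0 ≤ δ) (hδ' : δ ≤ 0.2) (hy : 0.48 ≤ y) (hq : 0 ≤ q)
    (hr : 0 ≤ r) (ha : (0.75 - y) ^ 2 ≤ r ^ 2 + q ^ 2)
    (h : (0.75 - y) ^ 2 + 2 * (0.56 + 0.8 * y - δ) * (y + q) ≤ (1 - δ) ^ 2 + y ^ 2) :
    0.8 * (0.75 - y) ≤ r := by
  by_contra! hcon
  have h1 : 0.6 * (0.75 - y) ≤ q := by
    by_contra! hcon'
    nlinarith only [ha, hcon, hcon', hr, hq]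
  have h2 := mul_le_mul_of_nonneg_left h1 (show 0 ≤ 2 * (0.56 + 0.8 * y - δ) by linarith)
  nlinarith only [h, h2, hδ, hδ', hy, sq_nonneg (y - 0.26),
    mul_nonneg hδ (sub_nonneg.2 hy), mul_nonneg hδ (sub_nonneg.2 hδ')]

/-- The second fan cannot end north of `c`: its chain, which ends at `(ξ, -v)` as seen from `c`, has
offset at least `r`, and this leaves no room for the hop. -/
theorem false_of_second_north {δ y r ξ v : ℝ} (hδ : 0 ≤ δ) (hδ' : δ ≤ 0.174) (hy : 0.48 ≤ y)
    (hy' : y ≤ 0.66) (hr : 0.8 * (0.75 - y) ≤ r) (hξ : r ≤ ξ) (hξ' : ξ ≤ 1 - δ) (hv : y ≤ v)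
    (hl : (0.56 + 0.8 * y - δ) ^ 2 ≤ ξ ^ 2 + v ^ 2)
    (h : 2 * y * v ≤ (1 - δ - ξ) ^ 2 + y ^ 2) : False := by
  have h0 : ξ ≤ 1 - δ - y := by
    by_contra! hcon
    nlinarith only [h, hv, hcon, hξ', hy]
  have h1 : (0.56 + 0.8 * y - δ - v) * y ≤ 0.42 * ξ ^ 2 := by
    rcases le_total (0.56 + 0.8 * y - δ) v with h' | h'
    · nlinarith only [h', hy, sq_nonneg ξ]
    · have h2 : (0.56 + 0.8 * y - δ - v) * (0.56 + 0.8 * y - δ + v) ≤ ξ ^ 2 := by linarith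
      have h3 : y ≤ 0.42 * (0.56 + 0.8 * y - δ + v) := by linarith
      nlinarith only [h2, mul_le_mul_of_nonneg_left h3 (sub_nonneg.2 h')]
  have h4 : 2 * (1 - δ) * ξ - 1.84 * ξ ^ 2 ≤
      (1 - δ) ^ 2 + y ^ 2 - 2 * (0.56 + 0.8 * y - δ) * y := by nlinarith only [h, h1]
  have h5 : 0.8 * (0.75 - y) ≤ ξ := hr.trans hξ
  -- The left-hand side of `h4` is concave in `ξ`, so that the ends of its range decide.
  have h6 : 0 ≤ (ξ - 0.8 * (0.75 - y)) * (0.52 - δ - ξ) :=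
    mul_nonneg (by linarith) (by linarith)
  nlinarith only [h4, h6, h5, hδ, hδ', hy, hy', h0, mul_nonneg hδ (sub_nonneg.2 hy),
    mul_nonneg (sub_nonneg.2 h5) hδ, mul_nonneg (sub_nonneg.2 h5) (sub_nonneg.2 hy)]

/-- A bound for the length `R` of a hop from a vertex at height `t` and offset `r`, if the hop is
not longer than the distance to `o`. -/
theorem second_hop_le {δ r t R : ℝ} (hδ : 0 ≤ δ) (hδ' : δ ≤ 0.2) (hr' : r ≤ 0.3)
    (ht : 0 ≤ t) (ht' : t ≤ 0.66) (hR : R ^ 2 ≤ (1 - δ - r) ^ 2 + t ^ 2) :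
    R ≤ 1.27 - 0.7 * δ - r := by
  refine le_of_sq_le_sq (a := R) ?_ (by linarith)
  nlinarith only [hR, hδ, hδ', hr', ht, ht', mul_nonneg hδ (sub_nonneg.2 hr')]

namespace Frame

variable {V : Type*} {F : Frame V} {p o c e E W : V}

/-- From a vertex `W` that is north-east of `c` and close to the vertical line through `c`,
south-eastern hops lead to a last such vertex `W'`; the hop from `W'` to `G` is no longer than the
distance from `W'` to `o`. -/
theorem exists_southeast_chain [Finite V] (hX : F.X o = 0) (hY : F.Y o = 0) (hcX : F.X c < -0.8)
    (hcY : 0.48 ≤ F.Y c) (hW : F.NE c W) (hWX : F.X W - F.X c < 0.3) :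
    ∃ W' G, F.NE c W' ∧ F.X W ≤ F.X W' ∧ F.X W' - F.X c < 0.3 ∧ F.Y W' ≤ F.Y W ∧
      F.reach W W' (F.X W' - F.X W + (F.Y W - F.Y W')) ∧ F.SE W' G ∧ F.reach W' G (F.d W' G) ∧
      F.d W' G ≤ F.d W' o ∧ (F.NE c G ∧ 0.3 ≤ F.X G - F.X c ∨ F.SE c G) := by
  obtain ⟨W', ⟨h1, h2, h3, h4, h5⟩, hlast⟩ := F.exists_easternmost
    (P := fun W' => F.NE c W' ∧ F.X W ≤ F.X W' ∧ F.X W' - F.X c < 0.3 ∧ F.Y W' ≤ F.Y W ∧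
      F.reach W W' (F.X W' - F.X W + (F.Y W - F.Y W'))) (u := W)
    ⟨hW, le_rfl, hWX, le_rfl, F.reach_mono (F.reach_refl W) (by linarith)⟩
  have hWo : F.SE W' o := F.SE_of_lt (by linarith) (by linarith [(F.ne_le h1).2])
  obtain ⟨G, hG, hr, hmin⟩ := F.hop_se hWo
  refine ⟨W', G, h1, h2, h3, h4, h5, hG, hr, hmin o hWo, ?_⟩
  rcases F.east_trans (Or.inl h1) (Or.inr hG) with h | h
  · refine Or.inl ⟨h, ?_⟩
    by_contra! hcon
    obtain ⟨h6, h7⟩ := F.se_le hG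
    refine hlast G (Or.inr hG) ⟨h, by linarith, hcon, by linarith,
      F.reach_mono (F.reach_trans h5 hr) ?_⟩
    have := F.d_le_of_SE hG
    change _ + F.d W' G ≤ _
    linarith
  · exact Or.inr h

/-- The remaining case: the second fan leaves `c` in the same way as the first one did. -/
theorem IsTerminal.win_of_second_fan [Finite V] (T : F.IsTerminal p o c) {G : V} {r K : ℝ}
    (hy : 0.48 ≤ F.Y c) (hy' : F.Y c ≤ 0.66) (hr : 0.8 * (0.75 - F.Y c) ≤ r)
    (hG : F.SE c G) (hGX : F.X G < 0) (hGX' : r ≤ F.X G - F.X c) (hGY : F.Y G < 0)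
    (hGY' : - F.Y G ≤ 0.63 - 0.7 * (1 + F.X c)) (hK : F.reach p G K)
    (hK' : K ≤ 6.09 + 8 * (1 + F.X c) - r)
    (hKG : F.reach c G (K - (1.4 + F.Y c + 9 * (1 + F.X c)))) :
    F.Win p o := by
  have h1 := T.le_X
  have h2 := T.X_lt
  have hcost := T.cost
  obtain ⟨E, W, hE, hEX, hEX', hEY, hEY', hEr, hEW, hWr, hWo, hcase⟩ :=
    exists_northeast_chain T.X_o T.Y_o hG hGX hGY
  have hcirc := d_sq_le_of_le_origin T.X_o T.Y_o hWo
  obtain ⟨h3, h4⟩ := F.ne_le hEW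
  have h5 := F.d_le_of_NE hEW
  rcases hcase with h | ⟨h, h' | ⟨hWX, hWY⟩⟩
  · exfalso
    obtain ⟨-, h6⟩ := F.ne_le h
    refine false_of_second_north (δ := 1 + F.X c) (y := F.Y c) (r := r) (ξ := F.X E - F.X c)
      (v := F.Y c - F.Y E) (by linarith) (by linarith) hy hy' hr (by linarith) (by linarith)
      (by linarith) (by linarith [T.le_d_sq hE]) ?_
    have h7 : F.Y c ^ 2 + 2 * F.Y c * (- F.Y E) ≤ F.Y W ^ 2 + 2 * F.Y W * (- F.Y E) := by
      nlinarith only [h6, hy, hEY']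
    linarith [sq_nonneg (F.X W - F.X E)]
  · have h6 : F.X W ≤ 0 := by
      by_contra! hcon
      nlinarith only [hcirc, hcon, hEX', hEY', h']
    have h7 : F.Y W ≤ 0.5 := by
      by_contra! hcon
      obtain ⟨h8, h9⟩ := F.se_le h
      have h10 : F.X W ≤ -0.125 := by
        by_contra! hcon'
        nlinarith only [hcirc, hcon, hcon', hEX', hEY', hEX, h1, hGX', hr, hy', h6,
          mul_nonneg h' (neg_nonneg.2 hEY'.le)]
      have h11 : (F.X W - F.X c) ^ 2 ≤ (- F.X c - 0.125) ^ 2 := by nlinarith only [h8, h10, h2]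
      have h12 : (F.Y W - F.Y c) ^ 2 ≤ 0.16 ^ 2 := by nlinarith only [h9, hcon, hy']
      have h13 : (- F.X c - 0.06) ^ 2 ≤ (0.56 + 0.8 * F.Y c - (1 + F.X c)) ^ 2 :=
        pow_le_pow_left₀ (by linarith) (by linarith) 2
      nlinarith only [T.le_d_sq h, h11, h12, h13, h2]
    exact T.win_of_shallow (n := 0.5) h h' le_rfl (by norm_num) (by linarith) h7
      (F.reach_trans (F.reach_trans hKG hEr) hWr) (by linarith)
  · have hrE := F.reach_trans hK hEr
    by_cases hs : - F.X E ≤ 0.55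
    · rcases le_total (- F.X E) (- F.Y E) with h6 | h6
      · exact F.win_of_reach (n := - F.Y E) T.X_o T.Y_o hrE (by linarith) (by linarith)
          (by linarith) (by linarith) (by linarith) (by linarith)
      · exact F.win_of_reach (n := - F.X E) T.X_o T.Y_o hrE (by linarith) (by linarith)
          (by linarith) (by linarith) (by linarith) (by linarith)
    have hrW := F.reach_trans hrE hWr
    have hw : F.X W ≤ 0.37 := by
      have h6 : F.Y E ^ 2 ≤ 0.63 ^ 2 := by nlinarith only [hEY, hEY', hGY', h1]
      by_contra! hcon
      nlinarith only [hcirc, hcon, hs, h6, sq_nonneg (F.Y W - F.Y E)]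
    rcases le_total (- F.Y W) 0.5 with h6 | h6
    · exact F.win_of_reach (n := 0.5) T.X_o T.Y_o hrW (by linarith) (by linarith)
        (by linarith) (by linarith) (by linarith) (by linarith)
    · exact F.win_of_reach (n := - F.Y W) T.X_o T.Y_o hrW (by linarith) (by linarith)
        (by linarith) (by linarith) (by linarith) (by linarith)

namespace IsTerminal

variable (T : F.IsTerminal p o c) (hF : F.IsFan o c e E W)

include T hF

/-- The case in which the frame has been reflected and `c` is far above `o`. -/
theorem win_of_fan_north_high [Finite V] (hW : F.NE c W) (hy : 0.48 ≤ F.Y c)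
    (hne : ∀ w, F.NE c w → 0.75 - F.Y c ≤ F.d c w) : F.Win p o := by
  have hX := T.le_X
  have hX' := T.X_lt
  have hcost := T.cost
  have hY := T.Y_le
  rcases le_total 0.27 (F.X E - F.X c) with hE | hE
  · exact T.win_of_fan_wide hF hW hE
  rcases le_total (1.4 + F.Y c + 9 * (1 + F.X c) + 2.76) (20.89 * (1 + F.X W)) with h | h
  · exact T.win_of_fan_north hF hW hE (by linarith) T.reach h le_rfl
  obtain ⟨h1, h2⟩ := F.ne_le hW
  have hc := T.fan_constraint hF hW (a := 0.75 - F.Y c) (by linarith) (by linarith)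
    (T.empty E hF.se_E) (by linarith) (hne W hW)
  have ha := pow_le_pow_left₀ (by linarith) (hne W hW) 2
  rw [F.d_sq] at ha
  have ht := north_height_le (δ := 1 + F.X c) (t := F.Y W) (by linarith) (by linarith) hy h2
    (T.fan_Y_le hF hE) (by linarith)
  have hr := north_offset_ge (δ := 1 + F.X c) (q := F.Y W - F.Y c) (r := F.X W - F.X c)
    (by linarith) (by linarith) hy (by linarith) (by linarith) ha (by linarith)
  obtain ⟨W', G, hW', hWX, hWX', hWY, hWr, hG, hGr, hGo, hcase⟩ :=
    exists_southeast_chain T.X_o T.Y_o hX' hy hW (by linarith)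
  obtain ⟨h3, h4⟩ := F.ne_le hW'
  obtain ⟨h5, h6⟩ := F.se_le hG
  have hcirc := d_sq_le_of_le_origin T.X_o T.Y_o hGo
  have hcG := F.reach_trans (F.reach_trans (T.fan_reach_le hF hE) hWr) hGr
  have hpG := F.reach_trans T.reach hcG
  have hR := second_hop_le (δ := 1 + F.X c) (r := F.X W' - F.X c) (t := F.Y W') (R := F.d W' G)
    (by linarith) (by linarith) (by linarith) (by linarith) (by linarith)
    (by rw [F.d_sq]; linarith)
  have hGX : F.X G ≤ 0.33 := by
    by_contra! hcon
    have h7 : F.Y W' ^ 2 ≤ 0.66 ^ 2 := pow_le_pow_left₀ (by linarith) (by linarith) 2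
    nlinarith only [hcirc, hcon, h7, hWX', hX', sq_nonneg (F.Y G - F.Y W')]
  rcases hcase with ⟨hcG', hg⟩ | hcG'
  · have h7 := F.d_le_of_SE hG
    have h8 := (F.ne_le hcG').2
    rcases le_total (- F.X G) (0.66 - 0.3 * (1 + F.X c)) with h9 | h9
    · exact F.win_of_reach (n := 0.66 - 0.3 * (1 + F.X c)) T.X_o T.Y_o hpG (by linarith)
        (by linarith) (by linarith) (by linarith) (by linarith) (by linarith)
    · exact F.win_of_reach (n := - F.X G) T.X_o T.Y_o hpG (by linarith)
        (by linarith) (by linarith) (by linarith) (by linarith) (by linarith)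
  rcases le_or_gt 0 (F.Y G) with h7 | h7
  · exact T.win_of_shallow (n := 0.66 - 0.3 * (1 + F.X c)) hcG' h7 (by linarith) (by linarith)
      (by linarith) (by linarith) hcG (by linarith)
  · have h8 : F.X G < 0 := by
      by_contra! hcon
      nlinarith only [hcirc, hcon, h7, h4, hy, hWX', hX']
    have h9 : - F.Y G ≤ 0.63 - 0.7 * (1 + F.X c) := by
      by_contra! hcon
      have h10 : F.X W' ^ 2 ≤ F.X c ^ 2 := by nlinarith only [h3, hWX', hX']
      have h11 : 0.48 ≤ F.Y W' := by linarith
      have h12 : F.Y G ^ 2 + 0.96 * (- F.Y G) ≤ F.X c ^ 2 := by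
        nlinarith only [hcirc, h10, h11, h7, sq_nonneg (F.X G - F.X W')]
      nlinarith only [h12, hcon, hX, hX']
    exact T.win_of_second_fan (r := F.X W - F.X c) hy (by linarith) hr hcG' h8 (by linarith) h7 h9
      hpG (by linarith) (F.reach_mono hcG (by linarith))

end IsTerminal

end Frame

/-! ### The contraction property -/

namespace Frame

variable {V : Type*} {F : Frame V} {p o : V}

theorem refl_d (a b : V) : F.refl.d a b = F.d a b := by
  simp only [d, coordDist, refl]
  congr 1
  ring

/-- The easternmost vertex of the sweep cannot be swept any further; it is terminal, in the given
frame or in the reflected one. -/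
theorem win_of_isSweepVertex [Finite V] (hX : F.X o = 0) (hY : F.Y o = 0)
    (h : ∃ u, F.IsSweepVertex p u) : F.Win p o := by
  obtain ⟨u, hu⟩ := h
  obtain ⟨c, ⟨hcX, hcX', hcY, hcY', hcr, hce⟩, hlast⟩ := F.exists_easternmost hu
  rcases le_or_gt (1.4 - F.Y c) (11.89 * (1 + F.X c)) with hcost | hcost
  · exact F.win_of_reach (n := - F.X c) hX hY hcr (by linarith) (by linarith) (by linarith)
      (by linarith) (by linarith) (by linarith)
  by_cases hse : ∀ w, F.SE c w → 0.75 + F.Y c ≤ F.d c w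
  · rcases F.east_of_lt (show F.X c < F.X o by linarith) with h | h
    · have hYc := (F.ne_le h).2
      have T : F.refl.IsTerminal p o c :=
        { X_o := hX
          Y_o := by simp [refl, hY]
          le_X := hcX
          X_lt := hcX'
          Y_nonneg := by simp only [refl]; linarith
          Y_le := by simp only [refl]; linarith
          se := h
          reach := F.reach_mono hcr (by simp only [refl]; linarith)
          cost := by simp only [refl]; linarith
          empty := fun w hw => by
            rw [refl_d]
            simp only [refl]
            linarith [hce w hw] }
      have hne : ∀ w, F.refl.NE c w → 0.75 - F.refl.Y c ≤ F.refl.d c w := fun w hw => by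
        rw [refl_d]
        simp only [refl]
        linarith [hse w hw]
      apply F.win_of_refl
      rcases T.win_or_exists_fan with hwin | ⟨e, E, W, hF, hW | ⟨hWX, hWY⟩⟩
      · exact hwin
      · rcases le_total (F.refl.Y c) 0.48 with hy | hy
        · exact T.win_of_fan_north_lower hF hW hy hne
        · exact T.win_of_fan_north_high hF hW hy hne
      · rcases le_total (F.refl.Y c) 0.3 with hy | hy
        · exact T.win_of_fan_south_of_low hF hWX hWY hy
        · exact T.win_of_fan_south_of_high hF hWX hWY hy
    · have hYc := (F.se_le h).2
      have T : F.IsTerminal p o c :=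
        { X_o := hX
          Y_o := hY
          le_X := hcX
          X_lt := hcX'
          Y_nonneg := by linarith
          Y_le := by linarith
          se := h
          reach := F.reach_mono hcr (by linarith)
          cost := by linarith
          empty := fun w hw => by linarith [hse w hw] }
      rcases T.win_or_exists_fan with hwin | ⟨e, E, W, hF, hW | ⟨hWX, hWY⟩⟩
      · exact hwin
      · exact T.win_of_fan_north_upper hF hW hcr hcost hse
          fun w hw => by linarith [hce w hw]
      · rcases le_total (F.Y c) 0.3 with hy | hy
        · exact T.win_of_fan_south_of_low hF hWX hWY hy
        · exact T.win_of_fan_south_of_high hF hWX hWY hy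
  · push Not at hse
    obtain ⟨z, hz, hzlt⟩ := hse
    obtain ⟨e, he, her, hmin⟩ := F.hop_se hz
    have hD : F.d c e < 0.75 + F.Y c := (hmin z hz).trans_lt hzlt
    have hDX := abs_le.1 (F.abs_X_le_d c e)
    have hDY := abs_le.1 (F.abs_Y_le_d c e)
    have hle := (F.se_le he).2
    rcases win_or_exists_isSweepVertex hX hY hcX hcr hce he her hmin (by linarith) (by linarith)
      (by linarith) (by linarith) with hwin | ⟨u', hu', hs⟩
    · exact hwin
    · exact absurd hs (hlast u' hu')

theorem win_of_west [Finite V] (hX : F.X o = 0) (hY : F.Y o = 0) (hpX : F.X p = -1)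
    (hpY : 0 ≤ F.Y p) (hpY' : F.Y p ≤ 1) : F.Win p o := by
  rcases le_or_gt (F.Y p) 0.7 with h | h
  · rcases win_or_exists_isSweepVertex_of_low hX hY hpX hpY h with hwin | hs
    · exact hwin
    · exact win_of_isSweepVertex hX hY hs
  · rcases win_or_exists_isSweepVertex_of_high hX hY hpX h hpY' with hwin | hs | hs
    · exact hwin
    · exact win_of_isSweepVertex hX hY hs
    · exact F.win_of_rot (F.rot.win_of_refl (win_of_isSweepVertex
        (by simp [rot, refl, hY]) (by simp [rot, refl, hX]) hs))

theorem win_of_X_eq_neg_one [Finite V] (hX : F.X o = 0) (hY : F.Y o = 0) (hpX : F.X p = -1)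
    (hpY : |F.Y p| ≤ 1) : F.Win p o := by
  rw [abs_le] at hpY
  rcases le_total 0 (F.Y p) with h | h
  · exact win_of_west hX hY hpX h hpY.2
  · exact F.win_of_refl (win_of_west hX (by simp [refl, hY]) hpX (by simp only [refl]; linarith)
      (by simp only [refl]; linarith))

/-- Every pair at distance `1` in the maximum norm has the contraction property. -/
theorem win_of_max_eq_one [Finite V] (F : Frame V) (p o : V) (hX : F.X o = 0) (hY : F.Y o = 0)
    (h : max |F.X p| |F.Y p| = 1) : F.Win p o := by
  have h1 : |F.X p| ≤ 1 := h ▸ le_max_left _ _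
  have h2 : |F.Y p| ≤ 1 := h ▸ le_max_right _ _
  rcases max_choice |F.X p| |F.Y p| with h3 | h3 <;> rw [h, eq_comm, abs_eq zero_le_one] at h3 <;>
    rcases h3 with h3 | h3
  · exact F.win_of_rot (F.rot.win_of_rot (win_of_X_eq_neg_one (by simp [rot, hX])
      (by simp [rot, hY]) (by simp [rot, h3]) (by simpa [rot] using h2)))
  · exact win_of_X_eq_neg_one hX hY h3 h2
  · exact F.win_of_rot (win_of_X_eq_neg_one (by simp [rot, hY]) (by simp [rot, hX])
      (by simp [rot, h3]) (by simpa [rot] using h1))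
  · exact F.win_of_rot (F.rot.win_of_rot (F.rot.rot.win_of_rot (win_of_X_eq_neg_one
      (by simp [rot, hY]) (by simp [rot, hX]) (by simp [rot, h3]) (by simpa [rot] using h1))))

end Frame

theorem mainTheorem3 (V : Finset Plane) (Y : SimpleGraph V) (hY : IsYaoFour V Y) :
    (∀ a b : V, (delInf V).Adj a b →
      ∃ p : Y.Walk a b, p.IsPath ∧
        walkLength p ≤ (11 + 7 * Real.sqrt 2) * dist (a : Plane) (b : Plane)) ∧
    IsSpanner ((11 + 7 * Real.sqrt 2) * Real.sqrt (4 + 2 * Real.sqrt 2)) Y := by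
  have hwalk : ∀ a b : V, WalkReach Y a b ((11 + 7 * √2) * dist (a : Plane) (b : Plane)) :=
    fun a b => (hY.walkReach Frame.win_of_max_eq_one a b).mono
      (mul_le_mul tau_le (dInf_le_dist _ _) (le_max_of_le_left (abs_nonneg _)) (by positivity))
  constructor
  · intro a b _
    obtain ⟨p, hp⟩ := hwalk a b
    obtain ⟨q, hq, hle⟩ := exists_isPath_walkLength_le p
    exact ⟨q, hq, hle.trans hp⟩
  · refine isSpanner_of_forall_walkReach (by positivity) fun a b => (hwalk a b).mono ?_
    exact mul_le_mul_of_nonneg_right (le_mul_of_one_le_right (by positivity) one_le_sqrt_four_add)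
      dist_nonneg
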